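/- \textbf{Setup.} Let $0<\gamma<1$. Let $\tau^i=-\tfrac{i}{2}\sigma^i$ ($i=1,2,3$, with $\sigma^i$ the Pauli matrices) be the standard basis of $\mathfrak{su}(2)$, identify $\mathbb R^3\cong\mathfrak{su}(2)$ by $n\mapsto n_i\tau^i$, and write $X\triangleright n$ for the adjoint action of $X\in SU(2)$. Elements of $Spin(4)=SU(2)\times SU(2)$ are written $G=(X^-,X^+)$; $Spin(4)$ acts on $\mathbb R^4$ by $\zeta(G\cdot V)=X^-\zeta(V)(X^+)^{-1}$ with $\zeta(V)=V^0I+i\sigma_iV^i$. Put $\mathcal N=(1,0,0,0)$. For $\{G_a\}_{a=0}^4\subset Spin(4)$ put $G_{ab}=(X^-_{ab},X^+_{ab})=G_a^{-1}G_b$ and, for $a\ne b$ and $\{c,d,e\}=\{0,\dots,4\}\setminus\{a,b\}$ (in any order), $$\beta_{ab}=-\mathrm{sgn}\big[\epsilon_{ijk}(G_{ac}\cdot\mathcal N)^i(G_{ad}\cdot\mathcal N)^j(G_{ae}\cdot\mathcal N)^k\,\epsilon_{lmn}(G_{bc}\cdot\mathcal N)^l(G_{bd}\cdot\mathcal N)^m(G_{be}\cdot\mathcal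 N)^n\big],\qquad \mathrm{sgn}(0)=0 .$$ Let $V_k$ be the spin-$k$ representation $\rho$ of $SU(2)$ with generators $\hat L^i=i\rho(\tau^i)$, let $V_{j^-,j^+}=V_{j^-}\otimes V_{j^+}$ be the corresponding representation of $Spin(4)$, with invariant bilinear form $\epsilon$ and antilinear map $J$ defined by $\epsilon(\Psi,\Phi)=\langle J\Psi,\Phi\rangle$. \emph{Boundary data} consist of a nonzero spin $k_{ab}=k_{ba}$ for each pair $a\neq b$ in $\{0,\dots,4\}$, such that $s^\pm_{ab}=\tfrac12|1\pm\gamma|k_{ab}$ are half-integers (i.e.\ lie in $\tfrac12\mathbb Z$), and a unit vector $n_{ab}\in\mathbb R^3$ for each ordered pair $a\neq b$. Let $|n_{ab}\rangle\in V_{k_{ab}}$ be a normalized eigenvector of $n_{ab}\cdot\hat L$ with eigenvalue $k_{ab}$ (with an arbitrary fixed phase), let $\iota_{k_{ab}}:V_{k_{ab}}\to V_{s^-_{ab},s^+_{ab}}$ be the isometric $SU(2)$-intertwiner, and let $$P_{ba}(\{G_{a'}\})=P_{(0,\infty)}\big(\beta_{ab}\,\mathrm{tr}(\tau_iX^-_{ba}X^+_{ab})\,\hat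 L^i\big)$$ be the spectral projector on $V_{k_{ab}}$ onto the positive part of the spectrum. The proper vertex action $S_{\gamma<1}$ is the (generally complex) function of $\{G_a\}$ defined by $$\exp(S_{\gamma<1})=\prod_{a<b}\big\langle J\,\iota_{k_{ab}}n_{ab},\ \rho(G_{ab})\,\iota_{k_{ab}}\,P_{ba}(\{G_{a'}\})\,n_{ba}\big\rangle ,$$ a determination of the logarithm being chosen locally where the right-hand side is nonzero. A \emph{critical point} of $S_{\gamma<1}$ is a point $\{G_a\}$ at which $S_{\gamma<1}$ is defined, is stationary under all variations of the $G_a$ in $Spin(4)$, and has nonnegative real part. \textbf{Theorem.} For $0<\gamma<1$ and given boundary data $\{k_{ab},n_{ab}\}$, $\{G_a\}$ is a critical point of $S_{\gamma<1}$ if and only if all of the following hold: \begin{itemize} \item (closure) $\sum_{b\ne a}k_{ab}\,n_{ab}=0$ for every $a$; \item (orientation) $X_a^{\pm}\triangleright n_{ab}=-X_b^{\pm}\triangleright n_{ba}$ for all $a\neq b$; \item (proper orientation) $\beta_{ab}\,\mathrm{tr}(\tau_iX^-_{ba}X^+_{ab})\,n^i_{ba}>0$ for all $a<b$. \end{itemize}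 -/

import Mathlib

open scoped Matrix Kronecker

noncomputable section

namespace ProperEPRL

/-! ### `SU(2)`, `Spin(4)` and their action on `ℝ⁴` -/

/-- `SU(2)`. -/
abbrev SU2 : Type := Matrix.specialUnitaryGroup (Fin 2) ℂ

/-- `Spin(4) = SU(2) × SU(2)`, an element being written `G = (X⁻, X⁺)`. -/
abbrev Spin4 : Type := SU2 × SU2

/-- The Pauli matrices. -/
def pauli : Fin 3 → Matrix (Fin 2) (Fin 2) ℂ :=
  ![!![0, 1; 1, 0], !![0, -Complex.I; Complex.I, 0], !![1, 0; 0, -1]]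

/-- The basis `τ^i = -(i/2) σ^i` of `su(2)`. -/
def tau (i : Fin 3) : Matrix (Fin 2) (Fin 2) ℂ := (-Complex.I / 2) • pauli i

/-- The element `v^i τ_i` of `su(2)` with components `v`. -/
def suVec (v : Fin 3 → ℝ) : Matrix (Fin 2) (Fin 2) ℂ := ∑ i, (v i : ℂ) • tau i

/-- The adjoint action `X ▷ x = X x X⁻¹` of `SU(2)` on `su(2)`. -/
def adj (X : SU2) (x : Matrix (Fin 2) (Fin 2) ℂ) : Matrix (Fin 2) (Fin 2) ℂ :=
  (X : Matrix (Fin 2) (Fin 2) ℂ) * x * ((X⁻¹ : SU2) : Matrix (Fin 2) (Fin 2) ℂ)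

/-- `tr(τ^i M)`; it is real for `M ∈ SU(2)`. -/
def trTau (M : Matrix (Fin 2) (Fin 2) ℂ) (i : Fin 3) : ℝ := (Matrix.trace (tau i * M)).re

/-- `ζ(V) = V⁰ I + i σ_i V^i` for `V ∈ ℝ⁴`. -/
def zeta (V : Fin 4 → ℝ) : Matrix (Fin 2) (Fin 2) ℂ :=
  (V 0 : ℂ) • 1 + ∑ i : Fin 3, (Complex.I * (V i.succ : ℂ)) • pauli i

/-- The components `V` of a matrix of the form `ζ(V)`. -/
def zetaInv (M : Matrix (Fin 2) (Fin 2) ℂ) : Fin 4 → ℝ :=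
  Fin.cons ((Matrix.trace M).re / 2) (trTau M)

/-- The action of `Spin(4)` on `ℝ⁴`, determined by `ζ(G · V) = X⁻ ζ(V) (X⁺)⁻¹`
(see `zeta_act`). -/
def act (G : Spin4) (V : Fin 4 → ℝ) : Fin 4 → ℝ :=
  zetaInv ((G.1 : Matrix (Fin 2) (Fin 2) ℂ) * zeta V *
    ((G.2⁻¹ : SU2) : Matrix (Fin 2) (Fin 2) ℂ))

/-- Matrices of the form `ζ(V)` are the `2 × 2` matrices with the entries of a quaternion. -/
theorem zeta_zetaInv {M : Matrix (Fin 2) (Fin 2) ℂ} (h1 : M 1 1 = star (M 0 0))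
    (h2 : M 1 0 = -star (M 0 1)) : zeta (zetaInv M) = M := by
  have e1 := congrArg Complex.re h1
  have e2 := congrArg Complex.im h1
  have e3 := congrArg Complex.re h2
  have e4 := congrArg Complex.im h2
  simp at e1 e2 e3 e4
  ext a b
  fin_cases a <;> fin_cases b <;> apply Complex.ext <;>
    simp [zetaInv, zeta, trTau, tau, pauli, Matrix.trace, Fin.sum_univ_succ, Matrix.mul_apply,
      e1, e2, e3, e4] <;> ring

theorem su2_entries (X : SU2) : X.1 1 1 = star (X.1 0 0) ∧ X.1 1 0 = -star (X.1 0 1) := by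
  have hX := Matrix.mem_specialUnitaryGroup_iff.1 X.2
  have hu : X.1 * star X.1 = 1 := Matrix.mem_unitaryGroup_iff.1 hX.1
  have hd : X.1.adjugate * X.1 = 1 := by rw [Matrix.adjugate_mul, hX.2, one_smul]
  have hs : X.1.adjugate = star X.1 := by
    calc X.1.adjugate = X.1.adjugate * (X.1 * star X.1) := by rw [hu, mul_one]
      _ = star X.1 := by rw [← mul_assoc, hd, one_mul]
  rw [Matrix.adjugate_fin_two] at hs
  have h0 := congrFun (congrFun hs 0) 0
  have h1 := congrFun (congrFun hs 0) 1
  simp only [Matrix.of_apply, Matrix.cons_val', Matrix.cons_val_zero, Matrix.cons_val_one,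
    Matrix.star_apply] at h0 h1
  exact ⟨h0, by rw [← star_star (X.1 1 0), ← h1, star_neg]⟩

theorem zeta_act (G : Spin4) (V : Fin 4 → ℝ) :
    zeta (act G V) = (G.1 : Matrix (Fin 2) (Fin 2) ℂ) * zeta V *
      ((G.2⁻¹ : SU2) : Matrix (Fin 2) (Fin 2) ℂ) := by
  obtain ⟨a1, a2⟩ := su2_entries G.1
  obtain ⟨b1, b2⟩ := su2_entries G.2⁻¹
  apply zeta_zetaInv
  · simp only [Matrix.mul_apply, Fin.sum_univ_two, a1, a2, b1, b2]
    simp [zeta, pauli, Fin.sum_univ_succ]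
    ring
  · simp only [Matrix.mul_apply, Fin.sum_univ_two, a1, a2, b1, b2]
    simp [zeta, pauli, Fin.sum_univ_succ]
    ring

/-- The reference vector `𝒩 = (1,0,0,0)`. -/
def refN : Fin 4 → ℝ := ![1, 0, 0, 0]

/-- `G_{ab} = (G_a)⁻¹ G_b`. -/
def rel (G : Fin 5 → Spin4) (a b : Fin 5) : Spin4 := (G a)⁻¹ * G b

/-- The spatial part `(G_{ab} · 𝒩)^i`. -/
def spatialN (G : Fin 5 → Spin4) (a b : Fin 5) : Fin 3 → ℝ :=
  fun i => act (rel G a b) refN i.succ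

/-- An enumeration of `{0,…,4} ∖ {a,b}`, for `a ≠ b` (see `others_spec`). -/
def others (a b : Fin 5) (i : Fin 3) : Fin 5 :=
  ((List.finRange 5).filter fun c => c ≠ a ∧ c ≠ b).getD i 0

theorem others_spec : ∀ a b : Fin 5, a ≠ b →
    (∀ i j, others a b i = others a b j → i = j) ∧
      ∀ c, (c ≠ a ∧ c ≠ b) ↔ ∃ i, others a b i = c := by
  decide

/-- `ε_{ijk} (G_{ac}·𝒩)^i (G_{ad}·𝒩)^j (G_{ae}·𝒩)^k`, where `{c,d,e} = {0,…,4} ∖ {a,b}`. -/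
def tripleN (G : Fin 5 → Spin4) (a b : Fin 5) : ℝ :=
  Matrix.det (Matrix.of fun i : Fin 3 => spatialN G a (others a b i))

/-- The sign `β_{ab}({G_{a'b'}}) ∈ {-1,0,1}`. The same enumeration of `{c,d,e}` is used in both
factors, so the value does not depend on it. -/
def beta (G : Fin 5 → Spin4) (a b : Fin 5) : ℝ :=
  -Real.sign (tripleN G a b *
    Matrix.det (Matrix.of fun i : Fin 3 => spatialN G b (others a b i)))

/-- The real 3-vector `β_{ab} tr(τ^i X⁻_{ba} X⁺_{ab})`. -/
def axis (G : Fin 5 → Spin4) (a b : Fin 5) : Fin 3 → ℝ :=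
  fun i => beta G a b * trTau (((rel G b a).1 * (rel G a b).2 : SU2) :
    Matrix (Fin 2) (Fin 2) ℂ) i

/-! ### Irreducible representations, realised on symmetric spinors

Spins are encoded by twice their value, a natural number. -/

/-- `g ⊗ ⋯ ⊗ g` (`N` factors) on `(ℂ²)^{⊗N}`. -/
def tensorPow (N : ℕ) (g : Matrix (Fin 2) (Fin 2) ℂ) :
    Matrix (Fin N → Fin 2) (Fin N → Fin 2) ℂ :=
  Matrix.of fun A B => ∏ r, g (A r) (B r)

/-- `∑_s 1 ⊗ ⋯ ⊗ x ⊗ ⋯ ⊗ 1`, with `x` in slot `s`, on `(ℂ²)^{⊗N}`. -/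
def tensorSum (N : ℕ) (x : Matrix (Fin 2) (Fin 2) ℂ) :
    Matrix (Fin N → Fin 2) (Fin N → Fin 2) ℂ :=
  Matrix.of fun A B => ∑ s, ∏ r,
    if r = s then x (A r) (B r) else (1 : Matrix (Fin 2) (Fin 2) ℂ) (A r) (B r)

/-- The carrying space `V_j`, `N = 2j`: symmetric spinors of rank `2j`, with the Hermitian inner
product of `(ℂ²)^{⊗2j}`. -/
def V (N : ℕ) : Submodule ℂ (EuclideanSpace ℂ (Fin N → Fin 2)) where
  carrier := {ψ | ∀ (π : Equiv.Perm (Fin N)) (A : Fin N → Fin 2), ψ (A ∘ π) = ψ A}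
  add_mem' h h' π A := by simp [h π A, h' π A]
  zero_mem' π A := by simp
  smul_mem' c ψ h π A := by simp [h π A]

/-- The carrying space `V_{j⁻,j⁺} = V_{j⁻} ⊗ V_{j⁺}` with `M = 2j⁻`, `N = 2j⁺`: spinors in
`(ℂ²)^{⊗M} ⊗ (ℂ²)^{⊗N}` which are symmetric in each of the two groups of indices. -/
def V₂ (M N : ℕ) : Submodule ℂ (EuclideanSpace ℂ ((Fin M → Fin 2) × (Fin N → Fin 2))) where
  carrier := {Ψ | ∀ (π : Equiv.Perm (Fin M)) (π' : Equiv.Perm (Fin N)) (A : Fin M → Fin 2)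
    (B : Fin N → Fin 2), Ψ (A ∘ π, B ∘ π') = Ψ (A, B)}
  add_mem' h h' π π' A B := by simp [h π π' A B, h' π π' A B]
  zero_mem' π π' A B := by simp
  smul_mem' c Ψ h π π' A B := by simp [h π π' A B]

theorem tensorPow_perm (N : ℕ) (g : Matrix (Fin 2) (Fin 2) ℂ) (π : Equiv.Perm (Fin N))
    (A B : Fin N → Fin 2) : tensorPow N g (A ∘ π) (B ∘ π) = tensorPow N g A B := by
  simpa [tensorPow] using Equiv.prod_comp π fun r => g (A r) (B r)

theorem tensorSum_perm (N : ℕ) (x : Matrix (Fin 2) (Fin 2) ℂ) (π : Equiv.Perm (Fin N))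
    (A B : Fin N → Fin 2) : tensorSum N x (A ∘ π) (B ∘ π) = tensorSum N x A B := by
  simp only [tensorSum, Matrix.of_apply, Function.comp_apply]
  rw [← Equiv.sum_comp π fun s => ∏ r,
    if r = s then x (A r) (B r) else (1 : Matrix (Fin 2) (Fin 2) ℂ) (A r) (B r)]
  refine Finset.sum_congr rfl fun s _ => ?_
  rw [← Equiv.prod_comp π fun r =>
    if r = π s then x (A r) (B r) else (1 : Matrix (Fin 2) (Fin 2) ℂ) (A r) (B r)]
  simp only [EmbeddingLike.apply_eq_iff_eq]
  rfl

/-- A matrix that is invariant under a permutation of the index set maps invariant vectors to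
invariant vectors. -/
theorem mulVec_invariant {I : Type*} [Fintype I] (e : Equiv.Perm I) (K : Matrix I I ℂ)
    (hK : ∀ A B, K (e A) (e B) = K A B) (ψ : I → ℂ) (hψ : ∀ A, ψ (e A) = ψ A) (A : I) :
    (K *ᵥ ψ) (e A) = (K *ᵥ ψ) A := by
  simp only [Matrix.mulVec, dotProduct]
  rw [← Equiv.sum_comp e]
  exact Finset.sum_congr rfl fun B _ => by rw [hK, hψ]

theorem V_invariant (N : ℕ) (K : Matrix (Fin N → Fin 2) (Fin N → Fin 2) ℂ)
    (hK : ∀ (π : Equiv.Perm (Fin N)) (A B : Fin N → Fin 2), K (A ∘ π) (B ∘ π) = K A B) :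
    ∀ ψ ∈ V N, Matrix.toEuclideanLin K ψ ∈ V N := fun ψ hψ π A =>
  mulVec_invariant (π.symm.arrowCongr (Equiv.refl (Fin 2))) K (fun A B => hK π A B) ψ
    (fun A => hψ π A) A

theorem V₂_invariant (M N : ℕ) (K : Matrix (Fin M → Fin 2) (Fin M → Fin 2) ℂ)
    (L : Matrix (Fin N → Fin 2) (Fin N → Fin 2) ℂ)
    (hK : ∀ (π : Equiv.Perm (Fin M)) (A B : Fin M → Fin 2), K (A ∘ π) (B ∘ π) = K A B)
    (hL : ∀ (π : Equiv.Perm (Fin N)) (A B : Fin N → Fin 2), L (A ∘ π) (B ∘ π) = L A B) :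
    ∀ Ψ ∈ V₂ M N, Matrix.toEuclideanLin (K ⊗ₖ L) Ψ ∈ V₂ M N := fun Ψ hΨ π π' A B =>
  mulVec_invariant ((π.symm.arrowCongr (Equiv.refl (Fin 2))).prodCongr
      (π'.symm.arrowCongr (Equiv.refl (Fin 2)))) (K ⊗ₖ L)
    (fun A B => congrArg₂ (· * ·) (hK π A.1 B.1) (hL π' A.2 B.2)) Ψ
    (fun A => hΨ π π' A.1 A.2) (A, B)

/-- The spin `N/2` representation of `SU(2)` on `V N`. -/
def rho (N : ℕ) (g : SU2) : V N →ₗ[ℂ] V N :=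
  (Matrix.toEuclideanLin (tensorPow N g.1)).restrict (V_invariant N _ (tensorPow_perm N g.1))

/-- The spin `N/2` representation of the Lie algebra `su(2)` on `V N`. -/
def rhoLie (N : ℕ) (x : Matrix (Fin 2) (Fin 2) ℂ) : V N →ₗ[ℂ] V N :=
  (Matrix.toEuclideanLin (tensorSum N x)).restrict (V_invariant N _ (tensorSum_perm N x))

/-- The generators `L̂^i = i ρ(τ^i)`. -/
def Lhat (N : ℕ) (i : Fin 3) : V N →ₗ[ℂ] V N := Complex.I • rhoLie N (tau i)

/-- `v · L̂ = v_i L̂^i`. -/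
def dotL (N : ℕ) (v : Fin 3 → ℝ) : V N →ₗ[ℂ] V N := ∑ i, (v i : ℂ) • Lhat N i

theorem dotL_apply (N : ℕ) (v : Fin 3 → ℝ) (ψ : V N) (A : Fin N → Fin 2) :
    (dotL N v ψ).1 A =
      ∑ i, (v i : ℂ) * (Complex.I * ∑ B, tensorSum N (tau i) A B * ψ.1 B) := by
  rw [dotL, LinearMap.sum_apply, Submodule.coe_sum, WithLp.ofLp_sum, Finset.sum_apply]
  rfl

/-- The representation `ρ(X⁻) ⊗ ρ(X⁺)` of `Spin(4)` on `V_{j⁻,j⁺}`. -/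
def rho₂ (M N : ℕ) (G : Spin4) : V₂ M N →ₗ[ℂ] V₂ M N :=
  (Matrix.toEuclideanLin (tensorPow M G.1.1 ⊗ₖ tensorPow N G.2.1)).restrict
    (V₂_invariant M N _ _ (tensorPow_perm M G.1.1) (tensorPow_perm N G.2.1))

/-- The alternating tensor `ε_{AB}`. -/
def eps : Matrix (Fin 2) (Fin 2) ℂ := !![0, 1; -1, 0]

/-- The invariant bilinear form `ε(Ψ, Φ)` on `V_{j⁻,j⁺}`. -/
def epsForm {M N : ℕ} (Ψ Φ : V₂ M N) : ℂ :=
  ∑ A, ∑ B, (tensorPow M eps ⊗ₖ tensorPow N eps) A B * Ψ.1 A * Φ.1 B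

/-- The antilinear structure map `J` on `V_{j⁻,j⁺}`, determined by `ε(Ψ, Φ) = ⟨J Ψ, Φ⟩`
(see `inner_J`). -/
def J {M N : ℕ} (Ψ : V₂ M N) : V₂ M N :=
  ⟨WithLp.toLp 2 fun B =>
      star (Matrix.toEuclideanLin (tensorPow M epsᵀ ⊗ₖ tensorPow N epsᵀ) Ψ.1 B),
    fun π π' A B => congrArg star (V₂_invariant M N _ _ (tensorPow_perm M epsᵀ)
      (tensorPow_perm N epsᵀ) Ψ.1 Ψ.2 π π' A B)⟩

theorem inner_J {M N : ℕ} (Ψ Φ : V₂ M N) : inner ℂ (J Ψ) Φ = epsForm Ψ Φ := by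
  rw [Submodule.coe_inner, PiLp.inner_apply, epsForm, Finset.sum_comm]
  refine Finset.sum_congr rfl fun B _ => ?_
  simp [J, Matrix.toLpLin_apply, Matrix.mulVec, dotProduct, tensorPow, Finset.mul_sum]
  refine Finset.sum_congr rfl fun A _ => ?_
  ring

/-- For `k = j⁻ + j⁺`, the isometric intertwiner `ι : V_k → V_{j⁻} ⊗ V_{j⁺}`; on symmetric spinors
it is the inclusion `Sym^{M+N} ⊆ Sym^M ⊗ Sym^N`. It is unique up to a phase. -/
def iota {K M N : ℕ} (h : M + N = K) : V K →ₗ[ℂ] V₂ M N where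
  toFun ψ := ⟨WithLp.toLp 2 fun AB => ψ.1 (Fin.append AB.1 AB.2 ∘ Fin.cast h.symm), by
    intro π π' A B
    subst h
    have := ψ.2 (finSumFinEquiv.permCongr (Equiv.sumCongr π π')) (Fin.append A B)
    have e : Fin.append A B ∘ (finSumFinEquiv.permCongr (Equiv.sumCongr π π')) =
        Fin.append (A ∘ π) (B ∘ π') := by
      funext i
      refine Fin.addCases (fun i => ?_) (fun i => ?_) i <;> simp [Equiv.permCongr_apply]
    rw [e] at this
    simpa using this⟩
  map_add' ψ φ := by ext; rfl
  map_smul' c ψ := by ext; rfl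

theorem norm_iota {K M N : ℕ} (h : M + N = K) (ψ : V K) : ‖iota h ψ‖ = ‖ψ‖ := by
  subst h
  rw [Submodule.coe_norm, Submodule.coe_norm, EuclideanSpace.norm_eq, EuclideanSpace.norm_eq]
  congr 1
  exact Equiv.sum_comp (Fin.appendEquiv M N) fun A => ‖ψ.1 A‖ ^ 2

theorem iota_intertwines {K M N : ℕ} (h : M + N = K) (g : SU2) (ψ : V K) :
    iota h (rho K g ψ) = rho₂ M N (g, g) (iota h ψ) := by
  subst h
  ext AB
  change ∑ C, tensorPow (M + N) g.1 (Fin.append AB.1 AB.2) C * ψ.1 C =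
    ∑ C : (Fin M → Fin 2) × (Fin N → Fin 2),
      (tensorPow M g.1 AB.1 C.1 * tensorPow N g.1 AB.2 C.2) * ψ.1 (Fin.append C.1 C.2)
  rw [← Equiv.sum_comp (Fin.appendEquiv M N)]
  refine Finset.sum_congr rfl fun C _ => ?_
  simp [tensorPow, Fin.prod_univ_add, Fin.appendEquiv]

/-- The spectral projector `P_S(T)` of a self-adjoint operator on a finite-dimensional space:
the orthogonal projector onto the span of the eigenspaces with eigenvalue in `S ⊆ ℝ`. -/
def spectralProjector {W : Type*} [NormedAddCommGroup W] [InnerProductSpace ℂ W]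
    [FiniteDimensional ℂ W] (S : Set ℝ) (T : W →ₗ[ℂ] W) : W →ₗ[ℂ] W :=
  (⨆ l ∈ S, Module.End.eigenspace T (l : ℂ)).starProjection.toLinearMap

/-- The projector `P_{ba}({G_{a'b'}}) = P_{(0,∞)}(β_{ab} tr(τ_i X⁻_{ba} X⁺_{ab}) L̂^i)` in the
representation of spin `N/2`. -/
def proj (N : ℕ) (G : Fin 5 → Spin4) (a b : Fin 5) : V N →ₗ[ℂ] V N :=
  spectralProjector (W := V N) (Set.Ioi 0) (dotL N (axis G a b))

/-! ### Coherent states -/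

/-- Unit vectors in `ℝ³`. -/
abbrev UnitVec : Type := Metric.sphere (0 : EuclideanSpace ℝ (Fin 3)) 1

/-- `ψ` is a normalised eigenstate of `n · L̂` with the highest eigenvalue `k = N/2`. -/
def IsHighest (N : ℕ) (n : UnitVec) (ψ : V N) : Prop :=
  ‖ψ‖ = 1 ∧ dotL N n.1 ψ = ((N : ℂ) / 2) • ψ

theorem exists_spinor (n : UnitVec) : ∃ z : Fin 2 → ℂ, ∑ A, ‖z A‖ ^ 2 = 1 ∧
    (Complex.I • suVec n.1) *ᵥ z = (1 / 2 : ℂ) • z := by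
  obtain ⟨n, hn⟩ := n
  have hn' : n 0 ^ 2 + n 1 ^ 2 + n 2 ^ 2 = 1 := by
    have := EuclideanSpace.norm_sq_eq n
    rw [mem_sphere_zero_iff_norm.1 hn] at this
    simp [Fin.sum_univ_three] at this
    linarith
  have key : ∀ z : Fin 2 → ℂ, z ≠ 0 → (Complex.I • suVec n) *ᵥ z = (1 / 2 : ℂ) • z →
      ∃ z : Fin 2 → ℂ, ∑ A, ‖z A‖ ^ 2 = 1 ∧ (Complex.I • suVec n) *ᵥ z = (1 / 2 : ℂ) • z := by
    intro z hz h
    set s : ℝ := ∑ A, ‖z A‖ ^ 2 with hs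
    have hpos : 0 < s := by
      obtain ⟨A, hA⟩ := Function.ne_iff.1 hz
      exact Finset.sum_pos' (fun _ _ => by positivity)
        ⟨A, Finset.mem_univ _, by have := norm_pos_iff.2 hA; positivity⟩
    refine ⟨(((Real.sqrt s)⁻¹ : ℝ) : ℂ) • z, ?_, ?_⟩
    · simp only [Pi.smul_apply, norm_smul, mul_pow, ← Finset.mul_sum, ← hs]
      rw [Complex.norm_real, Real.norm_eq_abs, sq_abs, inv_pow, Real.sq_sqrt hpos.le]
      exact inv_mul_cancel₀ hpos.ne'
    · rw [Matrix.mulVec_smul, h, smul_comm]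
  have hc : (n 0 : ℂ) ^ 2 + (n 1 : ℂ) ^ 2 + (n 2 : ℂ) ^ 2 = 1 := by
    rw [← Complex.ofReal_one, ← hn']
    push_cast
    rfl
  by_cases h3 : n 2 = -1
  · have h0 : n 0 = 0 := by nlinarith [sq_nonneg (n 0), sq_nonneg (n 1)]
    have h1 : n 1 = 0 := by nlinarith [sq_nonneg (n 0), sq_nonneg (n 1)]
    refine key ![0, 1] (fun h => by simpa using congrFun h 1) ?_
    ext A
    fin_cases A <;> simp [suVec, tau, pauli, Matrix.mulVec, dotProduct, Fin.sum_univ_three,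
      h0, h1, h3]
    linear_combination (-1 / 2 : ℂ) * Complex.I_sq
  · refine key ![1 + n 2, n 0 + Complex.I * n 1] (fun h => h3 ?_) ?_
    · have := congrFun h 0
      simp at this
      have : (1 : ℝ) + n 2 = 0 := by exact_mod_cast this
      linarith
    · ext A
      fin_cases A <;> simp [suVec, tau, pauli, Matrix.mulVec, dotProduct, Fin.sum_univ_three]
      · linear_combination (1 / 2 : ℂ) * hc + (1 / 2 * (n 1 : ℂ) ^ 2 * (Complex.I ^ 2 - 1) - 1 / 2 * ((n 2 : ℂ)
          + (n 2 : ℂ) ^ 2 + (n 0 : ℂ) ^ 2)) * Complex.I_sq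
      · linear_combination (-1 / 2 * (n 0 : ℂ) - 1 / 2 * Complex.I * (n 1 : ℂ)) * Complex.I_sq

theorem exists_isHighest (N : ℕ) (n : UnitVec) : ∃ ψ : V N, IsHighest N n ψ := by
  obtain ⟨z, hz, hev⟩ := exists_spinor n
  refine ⟨⟨WithLp.toLp 2 fun A => ∏ r, z (A r), fun π A => ?_⟩, ?_, ?_⟩
  · exact Equiv.prod_comp π fun r => z (A r)
  · rw [Submodule.coe_norm, EuclideanSpace.norm_eq, Real.sqrt_eq_one]
    simp only [norm_prod, ← Finset.prod_pow]
    rw [← Fintype.piFinset_univ, ← Finset.prod_univ_sum (fun _ : Fin N => Finset.univ)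
      fun _ b => ‖z b‖ ^ 2]
    simp [hz]
  · have hL : ∀ A B, ∑ i, (n.1 i : ℂ) * (Complex.I * tensorSum N (tau i) A B) =
        tensorSum N (Complex.I • suVec n.1) A B := by
      intro A B
      have hp : ∀ (x : Matrix (Fin 2) (Fin 2) ℂ) (s : Fin N), (∏ r,
          if r = s then x (A r) (B r) else (1 : Matrix (Fin 2) (Fin 2) ℂ) (A r) (B r)) =
          x (A s) (B s) * ∏ r ∈ Finset.univ.erase s,
            (1 : Matrix (Fin 2) (Fin 2) ℂ) (A r) (B r) := by
        intro x s
        rw [← Finset.mul_prod_erase _ _ (Finset.mem_univ s), if_pos rfl]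
        congr 1
        exact Finset.prod_congr rfl fun r hr => if_neg (Finset.ne_of_mem_erase hr)
      simp only [tensorSum, Matrix.of_apply, hp, Finset.mul_sum]
      rw [Finset.sum_comm]
      refine Finset.sum_congr rfl fun s _ => ?_
      simp only [suVec, Matrix.smul_apply, Matrix.sum_apply, smul_eq_mul, Finset.mul_sum,
        Finset.sum_mul]
      exact Finset.sum_congr rfl fun i _ => by ring
    have hT : ∀ A, ∑ B, tensorSum N (Complex.I • suVec n.1) A B * ∏ r, z (B r) =
        (N : ℂ) / 2 * ∏ r, z (A r) := by
      intro A
      set x := Complex.I • suVec n.1 with hx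
      simp only [tensorSum, Matrix.of_apply, Finset.sum_mul]
      rw [Finset.sum_comm]
      have : ∀ s : Fin N, (∑ B : Fin N → Fin 2, (∏ r, if r = s then x (A r) (B r) else
          (1 : Matrix (Fin 2) (Fin 2) ℂ) (A r) (B r)) * ∏ r, z (B r)) =
          1 / 2 * ∏ r, z (A r) := by
        intro s
        simp only [← Finset.prod_mul_distrib]
        rw [← Fintype.piFinset_univ, ← Finset.prod_univ_sum (fun _ : Fin N => Finset.univ)
          fun r b => (if r = s then x (A r) b else
            (1 : Matrix (Fin 2) (Fin 2) ℂ) (A r) b) * z b]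
        have h1 : ∀ r, (∑ b, (if r = s then x (A r) b else
            (1 : Matrix (Fin 2) (Fin 2) ℂ) (A r) b) * z b) =
            (if r = s then 1 / 2 else 1) * z (A r) := by
          intro r
          by_cases h : r = s
          · simpa [h, Matrix.mulVec, dotProduct] using congrFun hev (A s)
          · simp [h, Matrix.one_apply]
        simp only [h1, Finset.prod_mul_distrib]
        simp
      simp only [this]
      simp
      ring
    ext A
    rw [dotL_apply]
    refine Eq.trans ?_ (hT A)
    simp only [← hL, Finset.sum_mul, Finset.mul_sum]
    rw [Finset.sum_comm]
    exact Finset.sum_congr rfl fun B _ => Finset.sum_congr rfl fun i _ => by ring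

/-- The highest eigenstate `|n; k, k⟩`, `k = N/2`, with a phase fixed arbitrarily. -/
def highest (N : ℕ) (n : UnitVec) : V N := (exists_isHighest N n).choose

/-- The coherent state `|n, θ⟩_k = e^{iθ} |n; k, k⟩`, `k = N/2`. -/
def coherent (N : ℕ) (n : UnitVec) (θ : ℝ) : V N :=
  Complex.exp (Complex.I * θ) • highest N n

/-! ### Boundary data, action, critical points -/

/-- A nonzero allowed spin `k ∈ 𝒦_γ`: one for which `s^± = |1 ± γ| k / 2` are again half-integers.
Recorded are `2k`, `2s⁻` and `2s⁺`. -/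
structure AllowedSpin (γ : ℝ) where
  twoK : ℕ
  twoSm : ℕ
  twoSp : ℕ
  pos : 0 < twoK
  sm_eq : (twoSm : ℝ) = |1 - γ| / 2 * twoK
  sp_eq : (twoSp : ℝ) = |1 + γ| / 2 * twoK

/-- For `γ < 1` one has `s⁻ + s⁺ = k`. -/
theorem AllowedSpin.add_eq {γ : ℝ} (hγ : γ ∈ Set.Ioo (0 : ℝ) 1) (k : AllowedSpin γ) :
    k.twoSm + k.twoSp = k.twoK := by
  have h1 : |1 - γ| = 1 - γ := abs_of_pos (by linarith [hγ.2])
  have h2 : |1 + γ| = 1 + γ := abs_of_pos (by linarith [hγ.1])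
  have : ((k.twoSm + k.twoSp : ℕ) : ℝ) = k.twoK := by
    push_cast
    rw [k.sm_eq, k.sp_eq, h1, h2]
    ring
  exact_mod_cast this

/-- Quantum boundary data: one spin `k_{ab} = k_{ba}` per triangle and one unit vector `n_{ab}` per
ordered pair of distinct tetrahedra (diagonal entries are never used). -/
structure BoundaryData (γ : ℝ) where
  k : Fin 5 → Fin 5 → AllowedSpin γ
  k_symm : ∀ a b, k a b = k b a
  n : Fin 5 → Fin 5 → UnitVec

variable {γ : ℝ}

/-- The face factor `⟨J ι n_{ab}, ρ(G_{ab}) ι P_{ba}({G_{a'b'}}) n_{ba}⟩`, the phases of the coherent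
states `|n_{ab}⟩` being `θ_{ab}`. -/
def BoundaryData.faceFactor (D : BoundaryData γ) (hγ : γ ∈ Set.Ioo (0 : ℝ) 1)
    (θ : Fin 5 → Fin 5 → ℝ) (G : Fin 5 → Spin4) (a b : Fin 5) : ℂ :=
  inner ℂ
    (J (iota ((D.k a b).add_eq hγ) (coherent (D.k a b).twoK (D.n a b) (θ a b))))
    (rho₂ (D.k a b).twoSm (D.k a b).twoSp (rel G a b)
      (iota ((D.k a b).add_eq hγ)
        (proj (D.k a b).twoK G a b (coherent (D.k a b).twoK (D.n b a) (θ b a)))))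

/-- `exp(S_{γ<1})`, the integrand of the proper vertex amplitude. -/
def BoundaryData.expAction (D : BoundaryData γ) (hγ : γ ∈ Set.Ioo (0 : ℝ) 1)
    (θ : Fin 5 → Fin 5 → ℝ) (G : Fin 5 → Spin4) : ℂ :=
  ∏ a : Fin 5, ∏ b ∈ Finset.Ioi a, D.faceFactor hγ θ G a b

/-- A variation of `G`: a curve in `Spin(4)⁵` through `G` at parameter `0`, differentiable there. -/
def IsVariation (G : Fin 5 → Spin4) (c : ℝ → Fin 5 → Spin4) : Prop :=
  c 0 = G ∧ ∀ a i j, DifferentiableAt ℝ (fun t => (c t a).1.1 i j) 0 ∧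
    DifferentiableAt ℝ (fun t => (c t a).2.1 i j) 0

/-- `S` is stationary at `G`: its first variation exists and vanishes along every variation. -/
def IsStationary (S : (Fin 5 → Spin4) → ℂ) (G : Fin 5 → Spin4) : Prop :=
  ∀ c, IsVariation G c → HasDerivAt (fun t => S (c t)) 0 0

/-- `G` is a critical point of the action `S` defined by `exp S = E`: the action is stationary with
nonnegative real part. As `exp S = E` fixes `S` only modulo `2πi`, and only where `E ≠ 0`, `S` is a
local determination of the action near `G`; stationarity does not depend on its choice. -/
def IsCriticalPoint (E : (Fin 5 → Spin4) → ℂ) (G : Fin 5 → Spin4) : Prop :=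
  ∃ S : (Fin 5 → Spin4) → ℂ, (∀ᶠ H in nhds G, Complex.exp (S H) = E H) ∧
    IsStationary S G ∧ 0 ≤ (S G).re

/-- Closure: `∑_{b ≠ a} k_{ab} n_{ab} = 0` for every tetrahedron `a`
(the areas are proportional to the spins). -/
def BoundaryData.Closure (D : BoundaryData γ) : Prop :=
  ∀ a, ∑ b ∈ Finset.univ.erase a, ((D.k a b).twoK / 2 : ℝ) • (D.n a b).1 = 0

/-- Orientation: `X^±_a ▷ n_{ab} = - X^±_b ▷ n_{ba}` for all `a ≠ b`. -/
def BoundaryData.Orientation (D : BoundaryData γ) (G : Fin 5 → Spin4) : Prop :=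
  ∀ a b, a ≠ b →
    adj (G a).1 (suVec (D.n a b).1) = -adj (G b).1 (suVec (D.n b a).1) ∧
    adj (G a).2 (suVec (D.n a b).1) = -adj (G b).2 (suVec (D.n b a).1)

/-- Proper orientation: `β_{ab} tr(τ_i X⁻_{ba} X⁺_{ab}) n^i_{ba} > 0` for all `a < b`. -/
def BoundaryData.ProperOrientation (D : BoundaryData γ) (G : Fin 5 → Spin4) : Prop :=
  ∀ a b, a < b → 0 < ∑ i, axis G a b i * (D.n b a).1 i

end ProperEPRL

end

/-!
The proof compares the action with its largest possible modulus.

*Modulus.* Every map entering the face factor `⟨J ι n_{ab}, ρ(G_{ab}) ι P_{ba} n_{ba}⟩` is an isometry,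
except for the projector, so the factor has modulus at most `1`, and the real part of the action is
nonnegative exactly when every factor has modulus `1`. A highest eigenstate of `n · L̂` is, up to a
phase, the tensor power of the spinor `U e₀`, where `U ∈ SU(2)` rotates the third axis to `n`
(`IsHighest.eq_prod`). Without the projector the factor is therefore a phase times
`(W⁻₁₀)^{2s⁻} (W⁺₁₀)^{2s⁺}`, where `W^± ∈ SU(2)` is `X^±_{ab}` written in the frames of `n_{ab}` and
`n_{ba}` (`exists_faceForm_ket`). As both exponents are positive, its modulus is `1` exactly when both
`W^±` are antidiagonal, which is the orientation condition. In that case `X⁻_{ba} X⁺_{ab}` is a rotation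
about `n_{ba}`, so `|n_{ba}⟩` is an eigenvector of the operator whose spectral projector is taken, and
the projector fixes it or kills it according to the sign in the proper orientation condition
(`norm_faceFactor_eq_one_iff`).

*First variation.* At such a point the projector contributes nothing to first order. With `T` the
operator and `l > 0` its eigenvalue on `ψ = |n_{ba}⟩` at `G`, a nearby `T` gives
`l ‖ψ - P ψ‖ ≤ ‖T ψ - l ψ‖` (`mul_norm_sub_spectralProjector_le`), which is of first order; and the
part `ψ - P ψ` that is removed is paired with a vector which, by the equality case of the
Cauchy–Schwarz inequality, tends to a multiple of `ψ` (`exists_norm_faceFactor_sub_le`). The remaining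
powers have the logarithmic derivative `i tr(ξ_a n_{ab}) + i tr(ξ_b n_{ba})` per unit of `2s^±`, where
`ξ = X⁻¹ X'` (`hasDerivAt_frameRel`). Since `2s^± = (1 ± γ) k`, summing over the faces pairs each
velocity with the closure vector `∑_b k_{ab} n_{ab}` (`sum_logDeriv`), and the first variation vanishes
for all velocities exactly when the closure vectors do.
-/

noncomputable section

namespace ProperEPRL

/-! ### Tensor products of matrices -/

/-- The matrix `g₁ ⊗ ⋯ ⊗ g_N` on `(ℂ²)^{⊗N}`. -/
def tensorFam {N : ℕ} (g : Fin N → Matrix (Fin 2) (Fin 2) ℂ) :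
    Matrix (Fin N → Fin 2) (Fin N → Fin 2) ℂ :=
  Matrix.of fun A B => ∏ r, g r (A r) (B r)

theorem tensorPow_eq_tensorFam (N : ℕ) (g : Matrix (Fin 2) (Fin 2) ℂ) :
    tensorPow N g = tensorFam fun _ => g := rfl

theorem tensorSum_eq_sum_tensorFam (N : ℕ) (x : Matrix (Fin 2) (Fin 2) ℂ) :
    tensorSum N x = ∑ s, tensorFam fun r => if r = s then x else 1 := by
  ext A B
  simp only [tensorSum, tensorFam, Matrix.of_apply, Matrix.sum_apply]
  refine Finset.sum_congr rfl fun s _ => Finset.prod_congr rfl fun r _ => ?_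
  split_ifs <;> rfl

theorem tensorFam_mul {N : ℕ} (g h : Fin N → Matrix (Fin 2) (Fin 2) ℂ) :
    tensorFam g * tensorFam h = tensorFam fun r => g r * h r := by
  ext A B
  simp only [Matrix.mul_apply, tensorFam, Matrix.of_apply, ← Finset.prod_mul_distrib]
  rw [← Fintype.piFinset_univ, ← Finset.prod_univ_sum (fun _ : Fin N => Finset.univ)
    fun r b => g r (A r) b * h r b (B r)]

theorem tensorFam_one (N : ℕ) : tensorFam (fun _ : Fin N => 1) = 1 := by
  ext A B
  simp only [tensorFam, Matrix.of_apply, Matrix.one_apply, Finset.prod_ite_zero,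
    Finset.prod_const_one, funext_iff, Finset.mem_univ, true_imp_iff]

theorem tensorFam_conjTranspose {N : ℕ} (g : Fin N → Matrix (Fin 2) (Fin 2) ℂ) :
    (tensorFam g)ᴴ = tensorFam fun r => (g r)ᴴ := by
  ext A B
  simp [tensorFam, Matrix.conjTranspose_apply]

theorem tensorPow_mul (N : ℕ) (g h : Matrix (Fin 2) (Fin 2) ℂ) :
    tensorPow N g * tensorPow N h = tensorPow N (g * h) := tensorFam_mul _ _

theorem tensorPow_unitary (N : ℕ) {g : Matrix (Fin 2) (Fin 2) ℂ} (hg : gᴴ * g = 1) :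
    (tensorPow N g)ᴴ * tensorPow N g = 1 := by
  rw [tensorPow_eq_tensorFam, tensorFam_conjTranspose, tensorFam_mul, hg, tensorFam_one]

theorem tensorSum_conjTranspose (N : ℕ) {x : Matrix (Fin 2) (Fin 2) ℂ} (hx : xᴴ = x) :
    (tensorSum N x)ᴴ = tensorSum N x := by
  simp only [tensorSum_eq_sum_tensorFam, Matrix.conjTranspose_sum, tensorFam_conjTranspose]
  refine Finset.sum_congr rfl fun s _ => congrArg tensorFam (funext fun r => ?_)
  split_ifs
  · exact hx
  · exact Matrix.conjTranspose_one

theorem tensorPow_mul_tensorSum (N : ℕ) {g x y : Matrix (Fin 2) (Fin 2) ℂ} (h : g * x = y * g) :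
    tensorPow N g * tensorSum N x = tensorSum N y * tensorPow N g := by
  simp only [tensorSum_eq_sum_tensorFam, tensorPow_eq_tensorFam, Finset.mul_sum, Finset.sum_mul,
    tensorFam_mul]
  refine Finset.sum_congr rfl fun s _ => congrArg tensorFam (funext fun r => ?_)
  split_ifs
  · exact h
  · rw [mul_one, one_mul]

theorem sum_tensorPow_mul_prod (N : ℕ) (g : Matrix (Fin 2) (Fin 2) ℂ) (w : Fin 2 → ℂ)
    (A : Fin N → Fin 2) :
    ∑ B, tensorPow N g A B * ∏ r, w (B r) = ∏ r, (g *ᵥ w) (A r) := by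
  simp only [tensorPow, Matrix.of_apply, ← Finset.prod_mul_distrib]
  rw [← Fintype.piFinset_univ, ← Finset.prod_univ_sum (fun _ : Fin N => Finset.univ)
    fun r b => g (A r) b * w b]
  rfl

theorem sum_prod_mul_prod (N : ℕ) (z y : Fin 2 → ℂ) :
    ∑ A : Fin N → Fin 2, (∏ r, z (A r)) * ∏ r, y (A r) = (z ⬝ᵥ y) ^ N := by
  simp only [← Finset.prod_mul_distrib]
  rw [← Fintype.piFinset_univ, ← Finset.prod_univ_sum (fun _ : Fin N => Finset.univ)
    fun _ b => z b * y b]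
  simp [dotProduct]

theorem norm_toEuclideanLin_of_unitary {I : Type*} [Fintype I] [DecidableEq I]
    {K : Matrix I I ℂ} (hK : Kᴴ * K = 1) (x : EuclideanSpace ℂ I) :
    ‖Matrix.toEuclideanLin K x‖ = ‖x‖ := by
  have h : inner ℂ (Matrix.toEuclideanLin K x) (Matrix.toEuclideanLin K x) = inner ℂ x x := by
    rw [← LinearMap.adjoint_inner_right, ← Matrix.toEuclideanLin_conjTranspose_eq_adjoint,
      ← LinearMap.comp_apply, ← Matrix.toLpLin_mul_same, hK]
    simp
  rw [inner_self_eq_norm_sq_to_K, inner_self_eq_norm_sq_to_K] at h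
  have h' : ‖Matrix.toEuclideanLin K x‖ ^ 2 = ‖x‖ ^ 2 := by exact_mod_cast h
  exact (sq_eq_sq₀ (norm_nonneg _) (norm_nonneg _)).1 h'

theorem kronecker_unitary {I I' : Type*} [Fintype I] [DecidableEq I] [Fintype I'] [DecidableEq I']
    {K : Matrix I I ℂ} {L : Matrix I' I' ℂ} (hK : Kᴴ * K = 1) (hL : Lᴴ * L = 1) :
    (K ⊗ₖ L)ᴴ * (K ⊗ₖ L) = 1 := by
  rw [Matrix.conjTranspose_kronecker, ← Matrix.mul_kronecker_mul, hK, hL, Matrix.one_kronecker_one]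

theorem SU2.conjTranspose_mul (g : SU2) : (g.1)ᴴ * g.1 = 1 :=
  Matrix.mem_unitaryGroup_iff'.1 (Matrix.mem_specialUnitaryGroup_iff.1 g.2).1

theorem SU2.mul_conjTranspose (g : SU2) : g.1 * (g.1)ᴴ = 1 :=
  Matrix.mem_unitaryGroup_iff.1 (Matrix.mem_specialUnitaryGroup_iff.1 g.2).1

theorem SU2.coe_inv (g : SU2) : (g⁻¹ : SU2).1 = (g.1)ᴴ := rfl

theorem norm_rho₂ (M N : ℕ) (G : Spin4) (Ψ : V₂ M N) : ‖rho₂ M N G Ψ‖ = ‖Ψ‖ :=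
  norm_toEuclideanLin_of_unitary (kronecker_unitary (tensorPow_unitary M (SU2.conjTranspose_mul G.1))
    (tensorPow_unitary N (SU2.conjTranspose_mul G.2))) Ψ.1

theorem epsT_unitary : (epsᵀ)ᴴ * epsᵀ = 1 := by
  ext a b
  fin_cases a <;> fin_cases b <;> simp [eps, Matrix.mul_apply]

theorem norm_J {M N : ℕ} (Ψ : V₂ M N) : ‖J Ψ‖ = ‖Ψ‖ := by
  rw [Submodule.coe_norm, Submodule.coe_norm, ← norm_toEuclideanLin_of_unitary
    (kronecker_unitary (tensorPow_unitary M epsT_unitary) (tensorPow_unitary N epsT_unitary)) Ψ.1,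
    EuclideanSpace.norm_eq, EuclideanSpace.norm_eq]
  congr 1
  exact Finset.sum_congr rfl fun B _ => by rw [J, norm_star]

/-- The isometry `ρ(G) ∘ ι : V_k → V_{j⁻} ⊗ V_{j⁺}`. -/
def rhoIota {K M N : ℕ} (h : M + N = K) (G : Spin4) : V K →ₗ[ℂ] V₂ M N :=
  rho₂ M N G ∘ₗ iota h

theorem norm_rhoIota {K M N : ℕ} (h : M + N = K) (G : Spin4) (ψ : V K) :
    ‖rhoIota h G ψ‖ = ‖ψ‖ :=
  (norm_rho₂ M N G _).trans (norm_iota h ψ)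

theorem inner_map_map_of_norm {E F : Type*} [NormedAddCommGroup E] [InnerProductSpace ℂ E]
    [NormedAddCommGroup F] [InnerProductSpace ℂ F] (f : E → F)
    (hadd : ∀ x y, f (x + y) = f x + f y) (hsmul : ∀ (c : ℂ) x, f (c • x) = c • f x)
    (hnorm : ∀ x, ‖f x‖ = ‖x‖) (x y : E) : inner ℂ (f x) (f y) = inner ℂ x y :=
  LinearIsometry.inner_map_map
    ({ toFun := f, map_add' := hadd, map_smul' := hsmul, norm_map' := hnorm } : E →ₗᵢ[ℂ] F) x y

theorem inner_rhoIota {K M N : ℕ} (h : M + N = K) (G : Spin4) (ψ φ : V K) :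
    inner ℂ (rhoIota h G ψ) (rhoIota h G φ) = inner ℂ ψ φ :=
  inner_map_map_of_norm (E := V K) (F := V₂ M N) (rhoIota h G) (fun x y => map_add _ x y)
    (fun c x => map_smul _ c x) (norm_rhoIota h G) ψ φ

/-! ### The operators `v · L̂` -/

theorem I_smul_suVec_conjTranspose (v : Fin 3 → ℝ) :
    (Complex.I • suVec v)ᴴ = Complex.I • suVec v := by
  ext a b
  fin_cases a <;> fin_cases b <;> apply Complex.ext <;>
    simp [suVec, tau, pauli, Fin.sum_univ_three, Matrix.conjTranspose_apply] <;> ring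

theorem tensorSum_add (N : ℕ) (x y : Matrix (Fin 2) (Fin 2) ℂ) :
    tensorSum N (x + y) = tensorSum N x + tensorSum N y := by
  ext A B
  simp only [tensorSum, Matrix.of_apply, Matrix.add_apply, ← Finset.sum_add_distrib]
  refine Finset.sum_congr rfl fun s _ => ?_
  simp only [← Finset.mul_prod_erase _ _ (Finset.mem_univ s), if_true, add_mul]
  congr 2 <;>
  exact Finset.prod_congr rfl fun r hr => by simp [Finset.ne_of_mem_erase hr]

theorem tensorSum_smul (N : ℕ) (c : ℂ) (x : Matrix (Fin 2) (Fin 2) ℂ) :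
    tensorSum N (c • x) = c • tensorSum N x := by
  ext A B
  simp only [tensorSum, Matrix.of_apply, Matrix.smul_apply, Finset.smul_sum]
  refine Finset.sum_congr rfl fun s _ => ?_
  simp only [← Finset.mul_prod_erase _ _ (Finset.mem_univ s), if_true, smul_mul_assoc]
  congr 2
  exact Finset.prod_congr rfl fun r hr => by simp [Finset.ne_of_mem_erase hr]

/-- `v · L̂` is the restriction to symmetric spinors of `∑_s 1 ⊗ ⋯ ⊗ (i v^j τ_j) ⊗ ⋯ ⊗ 1`. -/
theorem coe_dotL (N : ℕ) (v : Fin 3 → ℝ) (ψ : V N) :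
    (dotL N v ψ).1 = Matrix.toEuclideanLin (tensorSum N (Complex.I • suVec v)) ψ.1 := by
  ext A
  rw [dotL_apply]
  simp only [suVec, Fin.sum_univ_three, tensorSum_smul, tensorSum_add, Matrix.toLpLin_apply,
    Matrix.mulVec, dotProduct, Matrix.smul_apply, Matrix.add_apply, smul_eq_mul, Finset.mul_sum,
    ← Finset.sum_add_distrib]
  exact Finset.sum_congr rfl fun B _ => by ring

theorem dotL_isSymmetric (N : ℕ) (v : Fin 3 → ℝ) :
    LinearMap.IsSymmetric (𝕜 := ℂ) (E := V N) (dotL N v) := by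
  intro ψ φ
  rw [Submodule.coe_inner, Submodule.coe_inner, coe_dotL, coe_dotL,
    ← LinearMap.adjoint_inner_right, ← Matrix.toEuclideanLin_conjTranspose_eq_adjoint,
    tensorSum_conjTranspose N (I_smul_suVec_conjTranspose v)]

theorem dotL_smul (N : ℕ) (s : ℝ) (v : Fin 3 → ℝ) (ψ : V N) :
    dotL N (s • v) ψ = (s : ℂ) • dotL N v ψ := by
  simp only [dotL, LinearMap.sum_apply, Finset.smul_sum, LinearMap.smul_apply, smul_smul,
    Pi.smul_apply, smul_eq_mul, Complex.ofReal_mul]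

theorem norm_dotL_sub_le (N : ℕ) (v w : Fin 3 → ℝ) (ψ : V N) :
    ‖dotL N v ψ - dotL N w ψ‖ ≤ ∑ i, ‖v i - w i‖ * ‖Lhat N i ψ‖ := by
  have : dotL N v ψ - dotL N w ψ = ∑ i, ((v i - w i : ℝ) : ℂ) • Lhat N i ψ := by
    simp [dotL, LinearMap.sum_apply, ← Finset.sum_sub_distrib, sub_smul]
  rw [this]
  refine (norm_sum_le _ _).trans (Finset.sum_le_sum fun i _ => ?_)
  rw [norm_smul, Complex.norm_real]

/-! ### Positive spectral projectors -/

section Spectral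

variable {W : Type*} [NormedAddCommGroup W] [InnerProductSpace ℂ W] [FiniteDimensional ℂ W]

theorem norm_spectralProjector_le (S : Set ℝ) (T : W →ₗ[ℂ] W) (ψ : W) :
    ‖spectralProjector S T ψ‖ ≤ ‖ψ‖ :=
  Submodule.norm_starProjection_apply_le _ ψ

theorem spectralProjector_apply_of_mem {S : Set ℝ} {T : W →ₗ[ℂ] W} {l : ℝ} (hl : l ∈ S) {ψ : W}
    (h : T ψ = (l : ℂ) • ψ) : spectralProjector S T ψ = ψ :=
  Submodule.starProjection_eq_self_iff.2 <| Submodule.mem_iSup_of_mem l <|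
    Submodule.mem_iSup_of_mem hl <| Module.End.mem_eigenspace_iff.2 h

theorem spectralProjector_apply_of_notMem {S : Set ℝ} {T : W →ₗ[ℂ] W} (hT : T.IsSymmetric) {l : ℝ}
    (hl : l ∉ S) {ψ : W} (h : T ψ = (l : ℂ) • ψ) : spectralProjector S T ψ = 0 := by
  refine (Submodule.starProjection_apply_eq_zero_iff _).2 ?_
  rw [← Submodule.iInf_orthogonal, Submodule.mem_iInf]
  intro m
  rw [Submodule.mem_orthogonal]
  intro x hx
  by_cases hm : m ∈ S
  swap
  · rw [iSup_neg hm, Submodule.mem_bot] at hx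
    rw [hx, inner_zero_left]
  rw [iSup_pos hm] at hx
  have hx' := Module.End.mem_eigenspace_iff.1 hx
  have key := hT x ψ
  rw [hx', h, inner_smul_left, inner_smul_right, Complex.conj_ofReal] at key
  have hne : (m : ℂ) - l ≠ 0 := by
    rw [← Complex.ofReal_sub, Complex.ofReal_ne_zero, sub_ne_zero]
    rintro rfl
    exact hl hm
  have : ((m : ℂ) - l) * inner ℂ x ψ = 0 := by rw [sub_mul, key, sub_self]
  exact (mul_eq_zero.1 this).resolve_left hne

/-- On the orthogonal complement of the positive eigenspaces the quadratic form is nonpositive. -/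
theorem re_inner_nonpos_of_mem_orthogonal {T : W →ₗ[ℂ] W} (hT : T.IsSymmetric) {x : W}
    (hx : x ∈ (⨆ l ∈ Set.Ioi (0 : ℝ), Module.End.eigenspace T (l : ℂ))ᗮ) :
    (inner ℂ x (T x)).re ≤ 0 := by
  set e := hT.eigenvectorBasis rfl
  rw [← e.sum_inner_mul_inner x (T x), Complex.re_sum]
  refine Finset.sum_nonpos fun i _ => ?_
  have h1 : inner ℂ (e i) (T x) = (hT.eigenvalues rfl i : ℂ) * inner ℂ (e i) x := by
    rw [← hT (e i) x, hT.apply_eigenvectorBasis rfl i, inner_smul_left]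
    simp [e]
  by_cases hi : 0 < hT.eigenvalues rfl i
  · have h2 : inner ℂ (e i) x = 0 := by
      refine (Submodule.mem_orthogonal _ _).1 hx _ ?_
      exact Submodule.mem_iSup_of_mem _ <| Submodule.mem_iSup_of_mem hi <|
        Module.End.mem_eigenspace_iff.2 (hT.apply_eigenvectorBasis rfl i)
    simp [h1, h2]
  · have h3 : inner ℂ x (e i) * inner ℂ (e i) (T x) =
        ((hT.eigenvalues rfl i * ‖inner ℂ x (e i)‖ ^ 2 : ℝ) : ℂ) := by
      rw [h1, ← inner_conj_symm (e i) x]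
      push_cast
      rw [← Complex.mul_conj']
      ring
    rw [h3, Complex.ofReal_re]
    exact mul_nonpos_of_nonpos_of_nonneg (not_lt.1 hi) (by positivity)

/-- A vector that is nearly an eigenvector of `T` with the positive eigenvalue `l` is nearly fixed by
the projector onto the positive part of the spectrum. -/
theorem mul_norm_sub_spectralProjector_le {T : W →ₗ[ℂ] W} (hT : T.IsSymmetric) (l : ℝ) (ψ : W) :
    l * ‖ψ - spectralProjector (Set.Ioi 0) T ψ‖ ≤ ‖T ψ - (l : ℂ) • ψ‖ := by
  set S : Submodule ℂ W := ⨆ l ∈ Set.Ioi (0 : ℝ), Module.End.eigenspace T (l : ℂ) with hS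
  set p := spectralProjector (Set.Ioi 0) T ψ with hp
  set q := ψ - p with hq
  have hpS : p ∈ S := Submodule.starProjection_apply_mem S ψ
  have hqS : q ∈ Sᗮ := Submodule.sub_starProjection_mem_orthogonal ψ
  have hTS : ∀ x ∈ S, T x ∈ S := by
    intro x hx
    have : S ≤ S.comap T := by
      rw [hS]
      refine iSup₂_le fun m hm y hy => ?_
      rw [Submodule.mem_comap, Module.End.mem_eigenspace_iff.1 hy]
      exact Submodule.smul_mem _ _ (Submodule.mem_iSup_of_mem m (Submodule.mem_iSup_of_mem hm hy))
    exact this hx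
  have h1 : inner ℂ q (T p) = 0 := (Submodule.mem_orthogonal' _ _).1 hqS _ (hTS p hpS)
  have h2 : inner ℂ q p = 0 := (Submodule.mem_orthogonal' _ _).1 hqS _ hpS
  have hψ : ψ = p + q := by rw [hq]; abel
  have h3 : inner ℂ q (T ψ - (l : ℂ) • ψ) = inner ℂ q (T q) - l * (‖q‖ : ℂ) ^ 2 := by
    rw [hψ, map_add, inner_sub_right, inner_smul_right, inner_add_right, inner_add_right, h1, h2,
      inner_self_eq_norm_sq_to_K]
    simp
  have h4 := congrArg Complex.re h3
  have h5 : (l * (‖q‖ : ℂ) ^ 2).re = l * ‖q‖ ^ 2 := by norm_cast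
  rw [Complex.sub_re, h5] at h4
  have h6 := re_inner_nonpos_of_mem_orthogonal hT hqS
  have h7 : -(inner ℂ q (T ψ - (l : ℂ) • ψ)).re ≤ ‖q‖ * ‖T ψ - (l : ℂ) • ψ‖ :=
    ((neg_le_abs _).trans (Complex.abs_re_le_norm _)).trans (norm_inner_le_norm _ _)
  rcases (norm_nonneg q).eq_or_lt with h0 | h0
  · rw [← h0]
    simp
  · nlinarith

end Spectral

/-! ### Coherent states as tensor powers of spinors -/

/-- `U` rotates the third axis to `v`: `(v · σ) U = U σ³`, with both sides halved, since
`i v^j τ_j = ½ v · σ`. -/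
def IsFrame (v : Fin 3 → ℝ) (U : SU2) : Prop :=
  (Complex.I • suVec v) * U.1 = U.1 * !![1 / 2, 0; 0, -1 / 2]

theorem exists_isFrame (n : UnitVec) : ∃ U : SU2, IsFrame n.1 U := by
  obtain ⟨z, hz, hev⟩ := exists_spinor n
  have hz' : z 0 * star (z 0) + z 1 * star (z 1) = 1 := by
    have : ((∑ A, ‖z A‖ ^ 2 : ℝ) : ℂ) = 1 := by rw [hz, Complex.ofReal_one]
    rw [Fin.sum_univ_two] at this
    push_cast at this
    rwa [← Complex.mul_conj', ← Complex.mul_conj'] at this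
  -- The second column is the spinor `J z` of `-n`.
  refine ⟨⟨!![z 0, -star (z 1); z 1, star (z 0)], Matrix.mem_specialUnitaryGroup_iff.2
    ⟨Matrix.mem_unitaryGroup_iff.2 ?_, ?_⟩⟩, ?_⟩
  · ext a b
    fin_cases a <;> fin_cases b <;> simp [Matrix.mul_apply, Matrix.star_apply] at hz' ⊢ <;>
      first | linear_combination hz' | ring
  · rw [Matrix.det_fin_two_of]
    linear_combination hz'
  · have h0 := congrFun hev 0
    have h1 := congrFun hev 1
    have c0 := congrArg star h0
    have c1 := congrArg star h1
    ext a b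
    fin_cases a <;> fin_cases b <;>
      simp [suVec, tau, pauli, Matrix.mulVec, dotProduct, Fin.sum_univ_three,
        Matrix.mul_apply] at h0 h1 c0 c1 ⊢
    · linear_combination h0
    · linear_combination c1
    · linear_combination h1
    · linear_combination -c0

/-- The highest eigenstate of `v · L̂` is the `N`-th tensor power of the spinor `U e₀`, up to a
phase. -/
theorem IsHighest.eq_prod {N : ℕ} {n : UnitVec} {ψ : V N} (hψ : IsHighest N n ψ) {U : SU2}
    (hU : IsFrame n.1 U) : ∃ c : ℂ, ‖c‖ = 1 ∧ ∀ A, ψ.1 A = c * ∏ r, U.1 (A r) 0 := by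
  set φ := Matrix.toEuclideanLin (tensorPow N (U.1)ᴴ) ψ.1 with hφ
  have hnorm : ‖φ‖ = 1 := by
    rw [hφ, norm_toEuclideanLin_of_unitary (tensorPow_unitary N _), ← Submodule.coe_norm, hψ.1]
    rw [Matrix.conjTranspose_conjTranspose, SU2.mul_conjTranspose]
  have hback : Matrix.toEuclideanLin (tensorPow N U.1) φ = ψ.1 := by
    rw [hφ, ← LinearMap.comp_apply, ← Matrix.toLpLin_mul_same, tensorPow_mul,
      SU2.mul_conjTranspose, tensorPow_eq_tensorFam, tensorFam_one]
    simp
  -- In the rotated frame `φ` is an eigenvector of a diagonal operator.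
  set d : Matrix (Fin 2) (Fin 2) ℂ := !![1 / 2, 0; 0, -1 / 2] with hd
  have hcomm : (U.1)ᴴ * (Complex.I • suVec n.1) = d * (U.1)ᴴ := by
    have h := congrArg (fun m => (U.1)ᴴ * m * (U.1)ᴴ) hU
    simp only at h
    rw [mul_assoc, mul_assoc, SU2.mul_conjTranspose, mul_one, ← mul_assoc, SU2.conjTranspose_mul,
      one_mul] at h
    exact h
  have heig : Matrix.toEuclideanLin (tensorSum N d) φ = ((N : ℂ) / 2) • φ := by
    rw [hφ, ← LinearMap.comp_apply, ← Matrix.toLpLin_mul_same,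
      ← tensorPow_mul_tensorSum N hcomm, Matrix.toLpLin_mul_same, LinearMap.comp_apply, ← coe_dotL,
      hψ.2]
    simp
  have hdiag : ∀ A : Fin N → Fin 2, A ≠ 0 → φ A = 0 := by
    intro A hA
    have h := congrFun (congrArg WithLp.ofLp heig) A
    have hsum : tensorSum N d = Matrix.diagonal fun A => ∑ s, d (A s) (A s) := by
      have hdd : ∀ i j, d i j = if i = j then d i i else 0 := by
        intro i j
        fin_cases i <;> fin_cases j <;> simp [d]
      ext A B
      simp only [tensorSum, Matrix.of_apply, Matrix.diagonal_apply]
      split_ifs with hAB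
      · subst hAB
        refine Finset.sum_congr rfl fun s _ => ?_
        simp
      · obtain ⟨r, hr⟩ := Function.ne_iff.1 hAB
        refine Finset.sum_eq_zero fun s _ => Finset.prod_eq_zero (Finset.mem_univ r) ?_
        split_ifs
        · rw [hdd, if_neg hr]
        · rw [Matrix.one_apply_ne hr]
    rw [hsum] at h
    simp only [Matrix.toLpLin_apply, Matrix.mulVec_diagonal, PiLp.smul_apply, smul_eq_mul] at h
    have hre : ∀ b : Fin 2, d b b = ((if b = 0 then (1 / 2) else (-1 / 2) : ℝ) : ℂ) := by
      intro b
      fin_cases b <;> simp [d]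
    have hlt : ∑ s, (if A s = 0 then (1 / 2) else (-1 / 2) : ℝ) < ∑ _s : Fin N, (1 / 2 : ℝ) := by
      obtain ⟨r, hr⟩ := Function.ne_iff.1 hA
      refine Finset.sum_lt_sum (fun s _ => ?_) ⟨r, Finset.mem_univ r, ?_⟩
      · split_ifs <;> norm_num
      · rw [if_neg (show A r ≠ 0 from hr)]
        norm_num
    have hne : (∑ s, d (A s) (A s)) - (N : ℂ) / 2 ≠ 0 := by
      simp only [hre]
      rw [Finset.sum_const, Finset.card_univ, Fintype.card_fin, nsmul_eq_mul] at hlt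
      intro h0
      have : ((∑ s, (if A s = 0 then (1 / 2) else (-1 / 2) : ℝ) - N / 2 : ℝ) : ℂ) = 0 := by
        push_cast at h0 ⊢
        exact h0
      rw [Complex.ofReal_eq_zero] at this
      linarith
    have : ((∑ s, d (A s) (A s)) - (N : ℂ) / 2) * φ A = 0 := by
      rw [sub_mul, h, sub_self]
    exact (mul_eq_zero.1 this).resolve_left hne
  have hsingle : φ = EuclideanSpace.single 0 (φ 0) := by
    ext A
    by_cases hA : A = 0
    · simp [hA]
    · rw [hdiag A hA]
      simp [hA]
  refine ⟨φ 0, ?_, fun A => ?_⟩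
  · rw [hsingle, PiLp.norm_single] at hnorm
    exact hnorm
  · rw [← hback]
    simp only [Matrix.toLpLin_apply, Matrix.mulVec, dotProduct]
    rw [Finset.sum_eq_single 0 (fun B _ hB => by rw [hdiag B hB, mul_zero]) (by simp)]
    simp [tensorPow, mul_comm]

theorem coherent_isHighest (N : ℕ) (n : UnitVec) (θ : ℝ) : IsHighest N n (coherent N n θ) := by
  obtain ⟨h1, h2⟩ := (exists_isHighest N n).choose_spec
  refine ⟨?_, ?_⟩
  · rw [coherent, norm_smul, highest, h1, mul_comm Complex.I, Complex.norm_exp_ofReal_mul_I, one_mul]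
  · rw [coherent, map_smul, highest, h2, smul_comm]

/-! ### Pairings of coherent states -/

theorem sum_kronecker_tensorPow_mul_prod {M N : ℕ} (g g' : Matrix (Fin 2) (Fin 2) ℂ)
    (d : ℂ) (w w' : Fin 2 → ℂ) (B : (Fin M → Fin 2) × (Fin N → Fin 2)) :
    ∑ C, (tensorPow M g ⊗ₖ tensorPow N g') B C * (d * ((∏ r, w (C.1 r)) * ∏ r, w' (C.2 r))) =
      d * ((∏ r, (g *ᵥ w) (B.1 r)) * ∏ r, (g' *ᵥ w') (B.2 r)) := by
  rw [← sum_tensorPow_mul_prod, ← sum_tensorPow_mul_prod, Finset.sum_mul_sum, Finset.mul_sum,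
    Fintype.sum_prod_type]
  refine Finset.sum_congr rfl fun C _ => ?_
  rw [Finset.mul_sum]
  refine Finset.sum_congr rfl fun C' _ => ?_
  rw [Matrix.kroneckerMap_apply]
  ring

theorem iota_apply_of_prod {K M N : ℕ} (h : M + N = K) {ψ : V K} {c : ℂ} {z : Fin 2 → ℂ}
    (hψ : ∀ A, ψ.1 A = c * ∏ r, z (A r)) (A : (Fin M → Fin 2) × (Fin N → Fin 2)) :
    (iota h ψ).1 A = c * ((∏ r, z (A.1 r)) * ∏ r, z (A.2 r)) := by
  subst h
  refine (hψ _).trans ?_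
  simp [Fin.prod_univ_add]

theorem inner_J_rho₂_of_prod {K M N : ℕ} (h : M + N = K) {ψ φ : V K} {c d : ℂ} {z w : Fin 2 → ℂ}
    (hψ : ∀ A, ψ.1 A = c * ∏ r, z (A r)) (hφ : ∀ A, φ.1 A = d * ∏ r, w (A r)) (G : Spin4) :
    inner ℂ (J (iota h ψ)) (rho₂ M N G (iota h φ)) =
      c * d * (z ⬝ᵥ eps *ᵥ (G.1.1 *ᵥ w)) ^ M * (z ⬝ᵥ eps *ᵥ (G.2.1 *ᵥ w)) ^ N := by
  have hρ : ∀ B, (rho₂ M N G (iota h φ)).1 B =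
      d * ((∏ r, (G.1.1 *ᵥ w) (B.1 r)) * ∏ r, (G.2.1 *ᵥ w) (B.2 r)) := by
    intro B
    rw [← sum_kronecker_tensorPow_mul_prod]
    change ∑ C, _ * (iota h φ).1 C = _
    exact Finset.sum_congr rfl fun C _ => by rw [iota_apply_of_prod h hφ]
  rw [inner_J, epsForm]
  have hA : ∀ A, ∑ B, (tensorPow M eps ⊗ₖ tensorPow N eps) A B * (iota h ψ).1 A *
      (rho₂ M N G (iota h φ)).1 B = (c * d) * (((∏ r, z (A.1 r)) *
        ∏ r, (eps *ᵥ (G.1.1 *ᵥ w)) (A.1 r)) * ((∏ r, z (A.2 r)) *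
        ∏ r, (eps *ᵥ (G.2.1 *ᵥ w)) (A.2 r))) := by
    intro A
    have h1 : ∀ B, (tensorPow M eps ⊗ₖ tensorPow N eps) A B * (iota h ψ).1 A *
        (rho₂ M N G (iota h φ)).1 B = (iota h ψ).1 A * ((tensorPow M eps ⊗ₖ tensorPow N eps) A B *
        (d * ((∏ r, (G.1.1 *ᵥ w) (B.1 r)) * ∏ r, (G.2.1 *ᵥ w) (B.2 r)))) := by
      intro B
      rw [hρ]
      ring
    rw [Finset.sum_congr rfl fun B _ => h1 B, ← Finset.mul_sum, sum_kronecker_tensorPow_mul_prod,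
      iota_apply_of_prod h hψ]
    ring
  rw [Finset.sum_congr rfl fun A _ => hA A, ← Finset.mul_sum, Fintype.sum_prod_type]
  simp only
  rw [← Finset.sum_mul_sum, sum_prod_mul_prod, sum_prod_mul_prod, ← mul_assoc]

theorem SU2.norm_sq_add_norm_sq (W : SU2) : ‖W.1 0 0‖ ^ 2 + ‖W.1 1 0‖ ^ 2 = 1 := by
  have h := congrFun (congrFun (SU2.conjTranspose_mul W) 0) 0
  simp only [Matrix.mul_apply, Fin.sum_univ_two, Matrix.conjTranspose_apply, Matrix.one_apply_eq]
    at h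
  rw [mul_comm, mul_comm (star _), ← starRingEnd_apply, ← starRingEnd_apply, Complex.mul_conj',
    Complex.mul_conj'] at h
  exact_mod_cast h

theorem SU2.norm_one_zero_le (W : SU2) : ‖W.1 1 0‖ ≤ 1 := by
  nlinarith [SU2.norm_sq_add_norm_sq W, sq_nonneg ‖W.1 0 0‖, norm_nonneg (W.1 1 0)]

theorem SU2.norm_one_zero_eq_one_iff (W : SU2) : ‖W.1 1 0‖ = 1 ↔ W.1 0 0 = 0 := by
  have h := SU2.norm_sq_add_norm_sq W
  constructor
  · intro h1
    rw [h1] at h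
    have : ‖W.1 0 0‖ ^ 2 = 0 := by linarith
    simpa using this
  · intro h0
    rw [h0] at h
    have : ‖W.1 1 0‖ ^ 2 = 1 := by simpa using h
    exact (pow_eq_one_iff_of_nonneg (norm_nonneg _) two_ne_zero).1 this

theorem dotProduct_eps_mulVec (U X Y : SU2) :
    (fun i => U.1 i 0) ⬝ᵥ eps *ᵥ (X.1 *ᵥ fun i => Y.1 i 0) = (U⁻¹ * X * Y : SU2).1 1 0 := by
  have e1 : (U⁻¹ : SU2).1 1 1 = U.1 0 0 := by
    rw [SU2.coe_inv, Matrix.conjTranspose_apply, (su2_entries U).1, star_star]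
  have e2 : (U⁻¹ : SU2).1 1 0 = -U.1 1 0 := by
    rw [SU2.coe_inv, Matrix.conjTranspose_apply, (su2_entries U).2, neg_neg]
  have : (U⁻¹ * X * Y : SU2).1 = (U⁻¹ : SU2).1 * X.1 * Y.1 := rfl
  rw [this]
  simp only [Matrix.mul_apply, Fin.sum_univ_two, e1, e2]
  simp [dotProduct, Matrix.mulVec, eps]
  ring

/-! ### The adjoint action and frames -/

theorem adj_mul (X Y : SU2) (x : Matrix (Fin 2) (Fin 2) ℂ) :
    adj (X * Y) x = adj X (adj Y x) := by
  have h1 : ((X * Y)⁻¹ : SU2).1 = (Y⁻¹ : SU2).1 * (X⁻¹ : SU2).1 := by rw [mul_inv_rev]; rfl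
  have h2 : (X * Y : SU2).1 = X.1 * Y.1 := rfl
  rw [adj, adj, adj, h1, h2]
  simp only [mul_assoc]

theorem adj_one (x : Matrix (Fin 2) (Fin 2) ℂ) : adj 1 x = x := by
  simp [adj]

theorem adj_neg (X : SU2) (x : Matrix (Fin 2) (Fin 2) ℂ) : adj X (-x) = -adj X x := by
  simp [adj]

theorem adj_inv_eq_iff (X : SU2) (x y : Matrix (Fin 2) (Fin 2) ℂ) :
    adj X⁻¹ x = y ↔ x = adj X y := by
  constructor
  · rintro rfl
    rw [← adj_mul, mul_inv_cancel, adj_one]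
  · rintro rfl
    rw [← adj_mul, inv_mul_cancel, adj_one]

theorem adj_smul (X : SU2) (c : ℂ) (x : Matrix (Fin 2) (Fin 2) ℂ) :
    adj X (c • x) = c • adj X x := by
  simp [adj]

theorem isFrame_iff_adj {v : Fin 3 → ℝ} {U : SU2} :
    IsFrame v U ↔ Complex.I • suVec v = adj U !![1 / 2, 0; 0, -1 / 2] := by
  rw [IsFrame, adj, SU2.coe_inv]
  constructor
  · intro h
    rw [← h, mul_assoc, SU2.mul_conjTranspose, mul_one]
  · intro h
    rw [h, mul_assoc, SU2.conjTranspose_mul, mul_one]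

/-- `X` maps `w` to `-v` exactly when it is antidiagonal with respect to frames of `w` and `v`. -/
theorem adj_suVec_eq_neg_iff {v w : Fin 3 → ℝ} {U Y : SU2} (hU : IsFrame v U) (hY : IsFrame w Y)
    (X : SU2) : adj X (suVec w) = -suVec v ↔ (U⁻¹ * X * Y : SU2).1 0 0 = 0 := by
  set d : Matrix (Fin 2) (Fin 2) ℂ := !![1 / 2, 0; 0, -1 / 2] with hd
  rw [isFrame_iff_adj] at hU hY
  set W : SU2 := U⁻¹ * X * Y with hW
  have h1 : adj X (suVec w) = -suVec v ↔ adj X (adj Y d) = -adj U d := by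
    rw [← hU, ← hY, adj_smul, ← smul_neg]
    exact (smul_right_injective _ Complex.I_ne_zero).eq_iff.symm
  have h2 : adj X (adj Y d) = -adj U d ↔ adj W d = -d := by
    rw [hW, adj_mul, adj_mul, ← adj_neg]
    constructor
    · intro h
      rw [h, ← adj_mul, inv_mul_cancel, adj_one]
    · intro h
      exact (adj_inv_eq_iff _ _ _).1 h
  have h3 : adj W d = -d ↔ W.1 * d = -d * W.1 := by
    rw [adj, SU2.coe_inv]
    constructor
    · intro h
      rw [← h, mul_assoc, SU2.conjTranspose_mul, mul_one]
    · intro h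
      rw [h, mul_assoc, SU2.mul_conjTranspose, mul_one]
  rw [h1, h2, h3]
  constructor
  · intro h
    have h00 := congrFun (congrFun h 0) 0
    simp [Matrix.mul_apply, d] at h00
    linear_combination h00
  · intro h
    have h11 : W.1 1 1 = 0 := by rw [(su2_entries W).1, h, star_zero]
    ext a b
    fin_cases a <;> fin_cases b <;> simp [Matrix.mul_apply, d, h, h11] <;> ring

theorem trTau_suVec (v : Fin 3 → ℝ) (i : Fin 3) : trTau (suVec v) i = -(1 / 2) * v i := by
  fin_cases i <;>
    simp [trTau, suVec, tau, pauli, Matrix.trace, Fin.sum_univ_succ] <;> ring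

theorem trTau_one (i : Fin 3) : trTau 1 i = 0 := by
  fin_cases i <;> simp [trTau, tau, pauli, Matrix.trace, Fin.sum_univ_succ]

theorem trTau_add (x y : Matrix (Fin 2) (Fin 2) ℂ) (i : Fin 3) :
    trTau (x + y) i = trTau x i + trTau y i := by
  simp [trTau, mul_add]

theorem trTau_real_smul (s : ℝ) (x : Matrix (Fin 2) (Fin 2) ℂ) (i : Fin 3) :
    trTau ((s : ℂ) • x) i = s * trTau x i := by
  simp [trTau]

/-- A rotation fixing `v` has its axis along `v`. -/
theorem exists_trTau_eq_of_adj_eq {v : Fin 3 → ℝ} {Y U : SU2} (hU : IsFrame v U)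
    (hY : adj Y (suVec v) = suVec v) : ∃ s : ℝ, ∀ i, trTau Y.1 i = s * v i := by
  set d : Matrix (Fin 2) (Fin 2) ℂ := !![1 / 2, 0; 0, -1 / 2] with hd
  rw [isFrame_iff_adj] at hU
  set W : SU2 := U⁻¹ * Y * U with hW
  have h1 : adj W d = d := by
    have := congrArg (fun x => Complex.I • x) hY
    rw [← adj_smul, hU] at this
    rw [hW, adj_mul, adj_mul, this, ← adj_mul, inv_mul_cancel, adj_one]
  have h2 : W.1 * d = d * W.1 := by
    conv_rhs => rw [← h1]
    rw [adj, SU2.coe_inv, mul_assoc _ _ W.1, SU2.conjTranspose_mul, mul_one]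
  have h01 : W.1 0 1 = 0 := by
    have h01 := congrFun (congrFun h2 0) 1
    simp [Matrix.mul_apply, d] at h01
    linear_combination -h01
  have h10 : W.1 1 0 = 0 := by rw [(su2_entries W).2, h01, star_zero, neg_zero]
  -- In the frame `U` the rotation is `diag(δ, δ̄) = Re δ + 2 i (Im δ) (σ³ / 2)`.
  have hdec : W.1 = ((W.1 0 0).re : ℂ) • 1 + ((2 * (W.1 0 0).im : ℝ) : ℂ) • Complex.I • d := by
    have h11 := (su2_entries W).1
    ext a b
    fin_cases a <;> fin_cases b
    · apply Complex.ext <;> simp [d]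
      ring
    · simp [h01, d]
    · simp [h10, d]
    · apply Complex.ext <;> simp [d, h11]
      ring
  have hYW : Y.1 = adj U W.1 := by
    have : Y = U * W * U⁻¹ := by rw [hW]; group
    conv_lhs => rw [this]
    rfl
  have hadj1 : adj U 1 = 1 := by
    rw [adj, mul_one, SU2.coe_inv, SU2.mul_conjTranspose]
  have hadj_add : ∀ x y, adj U (x + y) = adj U x + adj U y := by
    intro x y
    simp [adj, mul_add, add_mul]
  refine ⟨(W.1 0 0).im, fun i => ?_⟩
  have hfin : Y.1 = ((W.1 0 0).re : ℂ) • 1 + ((-2 * (W.1 0 0).im : ℝ) : ℂ) • suVec v := by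
    rw [hYW, hdec, hadj_add, adj_smul, adj_smul, adj_smul, hadj1, ← hU, smul_smul Complex.I,
      Complex.I_mul_I, ← hdec]
    push_cast
    rw [neg_smul, one_smul, smul_neg, neg_mul, neg_smul]
  rw [hfin, trTau_add, trTau_real_smul, trTau_real_smul, trTau_one, trTau_suVec]
  ring

/-- A frame of the unit vector `n`. -/
def frame (n : UnitVec) : SU2 := (exists_isFrame n).choose

theorem isFrame_frame (n : UnitVec) : IsFrame n.1 (frame n) := (exists_isFrame n).choose_spec

theorem rel_swap (G : Fin 5 → Spin4) (a b : Fin 5) : rel G b a = (rel G a b)⁻¹ := by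
  rw [rel, rel, mul_inv_rev, inv_inv]

theorem sum_sq_unitVec (n : UnitVec) : ∑ i, n.1 i * n.1 i = 1 := by
  have := EuclideanSpace.norm_sq_eq n.1
  rw [mem_sphere_zero_iff_norm.1 n.2] at this
  simpa [← sq] using this.symm

/-! ### The modulus of a face factor -/

variable {γ : ℝ}

theorem AllowedSpin.twoSm_pos (hγ : γ ∈ Set.Ioo (0 : ℝ) 1) (k : AllowedSpin γ) : 0 < k.twoSm := by
  have h : (0 : ℝ) < k.twoSm := by
    rw [k.sm_eq, abs_of_pos (by linarith [hγ.2])]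
    have := k.pos
    have := hγ.2
    have : (0 : ℝ) < 1 - γ := by linarith
    positivity
  exact_mod_cast h

theorem AllowedSpin.twoSp_pos (hγ : γ ∈ Set.Ioo (0 : ℝ) 1) (k : AllowedSpin γ) : 0 < k.twoSp := by
  have h : (0 : ℝ) < k.twoSp := by
    rw [k.sp_eq, abs_of_pos (by linarith [hγ.1])]
    have := k.pos
    have := hγ.1
    positivity
  exact_mod_cast h

namespace BoundaryData

variable (D : BoundaryData γ) (hγ : γ ∈ Set.Ioo (0 : ℝ) 1) (θ : Fin 5 → Fin 5 → ℝ)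

/-- The linear form `φ ↦ ⟨J ι n_{ab}, ρ(G_{ab}) ι φ⟩` on `V_{k_{ab}}`. -/
def faceForm (G : Fin 5 → Spin4) (a b : Fin 5) (φ : V (D.k a b).twoK) : ℂ :=
  inner ℂ
    (J (iota ((D.k a b).add_eq hγ) (coherent (D.k a b).twoK (D.n a b) (θ a b))))
    (rhoIota ((D.k a b).add_eq hγ) (rel G a b) φ)

/-- The coherent state `|n_{ba}⟩ ∈ V_{k_{ab}}`. -/
abbrev ket (a b : Fin 5) : V (D.k a b).twoK := coherent (D.k a b).twoK (D.n b a) (θ b a)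

/-- `X_{ab}` expressed in the frames of `n_{ab}` and `n_{ba}`. -/
def frameRel (X : Fin 5 → SU2) (a b : Fin 5) : SU2 :=
  (frame (D.n a b))⁻¹ * ((X a)⁻¹ * X b) * frame (D.n b a)

theorem faceFactor_eq_faceForm (G : Fin 5 → Spin4) (a b : Fin 5) :
    D.faceFactor hγ θ G a b =
      D.faceForm hγ θ G a b (proj (D.k a b).twoK G a b (D.ket θ a b)) := rfl

theorem norm_ket (a b : Fin 5) : ‖D.ket θ a b‖ = 1 := (coherent_isHighest _ _ _).1

theorem norm_bra (a b : Fin 5) :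
    ‖(J (iota ((D.k a b).add_eq hγ) (coherent (D.k a b).twoK (D.n a b) (θ a b))) :
      V₂ (D.k a b).twoSm (D.k a b).twoSp)‖ = 1 := by
  rw [norm_J, norm_iota]
  exact (coherent_isHighest _ _ _).1

theorem norm_faceForm_le (G : Fin 5 → Spin4) (a b : Fin 5) (φ : V (D.k a b).twoK) :
    ‖D.faceForm hγ θ G a b φ‖ ≤ ‖φ‖ := by
  refine (norm_inner_le_norm (𝕜 := ℂ) (E := V₂ (D.k a b).twoSm (D.k a b).twoSp) _ _).trans ?_
  rw [D.norm_bra hγ, one_mul, norm_rhoIota]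

theorem faceForm_sub (G : Fin 5 → Spin4) (a b : Fin 5) (φ χ : V (D.k a b).twoK) :
    D.faceForm hγ θ G a b (φ - χ) = D.faceForm hγ θ G a b φ - D.faceForm hγ θ G a b χ := by
  rw [faceForm, map_sub]
  exact inner_sub_right (𝕜 := ℂ) (E := V₂ (D.k a b).twoSm (D.k a b).twoSp) _ _ _

/-- Without the projector, the face factor of spin `k` is a product of powers of spin-`1/2` ones. -/
theorem exists_faceForm_ket (a b : Fin 5) : ∃ C : ℂ, ‖C‖ = 1 ∧ ∀ G : Fin 5 → Spin4,
    D.faceForm hγ θ G a b (D.ket θ a b) =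
      C * (D.frameRel (fun c => (G c).1) a b).1 1 0 ^ (D.k a b).twoSm *
        (D.frameRel (fun c => (G c).2) a b).1 1 0 ^ (D.k a b).twoSp := by
  obtain ⟨c, hc, hψ⟩ := (coherent_isHighest (D.k a b).twoK (D.n a b) (θ a b)).eq_prod
    (isFrame_frame (D.n a b))
  obtain ⟨d, hd, hφ⟩ := (coherent_isHighest (D.k a b).twoK (D.n b a) (θ b a)).eq_prod
    (isFrame_frame (D.n b a))
  refine ⟨c * d, by rw [norm_mul, hc, hd, one_mul], fun G => ?_⟩
  refine (inner_J_rho₂_of_prod ((D.k a b).add_eq hγ) (z := fun i => (frame (D.n a b)).1 i 0)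
    (w := fun i => (frame (D.n b a)).1 i 0) hψ hφ (rel G a b)).trans ?_
  rw [dotProduct_eps_mulVec, dotProduct_eps_mulVec]
  rfl

/-- The orientation condition for a single face. -/
def FaceOriented (G : Fin 5 → Spin4) (a b : Fin 5) : Prop :=
  adj (G a).1 (suVec (D.n a b).1) = -adj (G b).1 (suVec (D.n b a).1) ∧
    adj (G a).2 (suVec (D.n a b).1) = -adj (G b).2 (suVec (D.n b a).1)

theorem adj_rel_eq_neg_iff (X Y : SU2) (x y : Matrix (Fin 2) (Fin 2) ℂ) :
    adj (X⁻¹ * Y) y = -x ↔ adj X x = -adj Y y := by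
  rw [adj_mul, adj_inv_eq_iff, adj_neg, eq_neg_iff_add_eq_zero, eq_neg_iff_add_eq_zero, add_comm]

theorem faceOriented_iff_frameRel (G : Fin 5 → Spin4) (a b : Fin 5) : D.FaceOriented G a b ↔
    (D.frameRel (fun c => (G c).1) a b).1 0 0 = 0 ∧
      (D.frameRel (fun c => (G c).2) a b).1 0 0 = 0 := by
  rw [frameRel, frameRel, ← adj_suVec_eq_neg_iff (isFrame_frame _) (isFrame_frame _),
    ← adj_suVec_eq_neg_iff (isFrame_frame _) (isFrame_frame _), adj_rel_eq_neg_iff,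
    adj_rel_eq_neg_iff, FaceOriented]

theorem norm_faceForm_ket_eq_one_iff (G : Fin 5 → Spin4) (a b : Fin 5) :
    ‖D.faceForm hγ θ G a b (D.ket θ a b)‖ = 1 ↔ D.FaceOriented G a b := by
  obtain ⟨C, hC, h⟩ := D.exists_faceForm_ket hγ θ a b
  rw [h, faceOriented_iff_frameRel, ← SU2.norm_one_zero_eq_one_iff,
    ← SU2.norm_one_zero_eq_one_iff, norm_mul, norm_mul, hC, one_mul, norm_pow, norm_pow]
  have hM := ((D.k a b).twoSm_pos hγ).ne'
  have hN := ((D.k a b).twoSp_pos hγ).ne'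
  set x := ‖(D.frameRel (fun c => (G c).1) a b).1 1 0‖
  set y := ‖(D.frameRel (fun c => (G c).2) a b).1 1 0‖
  have hx0 : 0 ≤ x := norm_nonneg _
  have hy0 : 0 ≤ y := norm_nonneg _
  have hx1 : x ^ (D.k a b).twoSm ≤ 1 := pow_le_one₀ hx0 (SU2.norm_one_zero_le _)
  have hy1 : y ^ (D.k a b).twoSp ≤ 1 := pow_le_one₀ hy0 (SU2.norm_one_zero_le _)
  constructor
  · intro hxy
    have hx : x ^ (D.k a b).twoSm = 1 := by nlinarith [pow_nonneg hx0 (D.k a b).twoSm]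
    have hy : y ^ (D.k a b).twoSp = 1 := by nlinarith [pow_nonneg hy0 (D.k a b).twoSp]
    exact ⟨(pow_eq_one_iff_of_nonneg hx0 hM).1 hx, (pow_eq_one_iff_of_nonneg hy0 hN).1 hy⟩
  · rintro ⟨hx, hy⟩
    rw [hx, hy, one_pow, one_pow, one_mul]

/-- At an oriented face the axis `β_{ab} tr(τ^i X⁻_{ba} X⁺_{ab})` is a multiple of `n_{ba}`. -/
theorem FaceOriented.axis_eq {D : BoundaryData γ} {G : Fin 5 → Spin4} {a b : Fin 5}
    (h : D.FaceOriented G a b) :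
    axis G a b = (∑ i, axis G a b i * (D.n b a).1 i) • (D.n b a).1.ofLp := by
  have hfix : adj ((rel G b a).1 * (rel G a b).2) (suVec (D.n b a).1) = suVec (D.n b a).1 := by
    have h1 : adj (rel G a b).1 (suVec (D.n b a).1) = -suVec (D.n a b).1 :=
      (adj_rel_eq_neg_iff _ _ _ _).2 h.1
    have h2 : adj (rel G a b).2 (suVec (D.n b a).1) = -suVec (D.n a b).1 :=
      (adj_rel_eq_neg_iff _ _ _ _).2 h.2
    rw [adj_mul, h2, ← h1, rel_swap, Prod.fst_inv, ← adj_mul, inv_mul_cancel, adj_one]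
  obtain ⟨s, hs⟩ := exists_trTau_eq_of_adj_eq (isFrame_frame _) hfix
  have hax : ∀ i, axis G a b i = beta G a b * s * (D.n b a).1 i := by
    intro i
    rw [axis, hs, mul_assoc]
  have hsum : ∑ i, axis G a b i * (D.n b a).1 i = beta G a b * s := by
    simp only [hax, mul_assoc (beta G a b * s)]
    rw [← Finset.mul_sum, sum_sq_unitVec, mul_one]
  ext i
  rw [hsum, hax]
  rfl

theorem FaceOriented.dotL_ket {D : BoundaryData γ} {G : Fin 5 → Spin4} {a b : Fin 5}
    (h : D.FaceOriented G a b) :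
    dotL (D.k a b).twoK (axis G a b) (D.ket θ a b) =
      (((∑ i, axis G a b i * (D.n b a).1 i) * ((D.k a b).twoK / 2) : ℝ) : ℂ) • D.ket θ a b := by
  conv_lhs => rw [h.axis_eq]
  rw [dotL_smul, (coherent_isHighest _ _ _).2, smul_smul]
  push_cast
  rfl

theorem FaceOriented.proj_ket_of_pos {D : BoundaryData γ} {G : Fin 5 → Spin4} {a b : Fin 5}
    (h : D.FaceOriented G a b) (hpos : 0 < ∑ i, axis G a b i * (D.n b a).1 i) :
    proj (D.k a b).twoK G a b (D.ket θ a b) = D.ket θ a b := by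
  have := (D.k a b).pos
  exact spectralProjector_apply_of_mem (W := V (D.k a b).twoK) (Set.mem_Ioi.2 (by positivity))
    (h.dotL_ket θ)

theorem norm_faceFactor_le_one (G : Fin 5 → Spin4) (a b : Fin 5) :
    ‖D.faceFactor hγ θ G a b‖ ≤ 1 := by
  rw [faceFactor_eq_faceForm]
  refine (D.norm_faceForm_le hγ θ G a b _).trans ?_
  rw [← D.norm_ket θ a b]
  exact norm_spectralProjector_le (W := V (D.k a b).twoK) _ _ _

/-- The modulus of a face factor is maximal exactly at the properly oriented faces. -/
theorem norm_faceFactor_eq_one_iff (G : Fin 5 → Spin4) (a b : Fin 5) :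
    ‖D.faceFactor hγ θ G a b‖ = 1 ↔
      D.FaceOriented G a b ∧ 0 < ∑ i, axis G a b i * (D.n b a).1 i := by
  rw [faceFactor_eq_faceForm]
  constructor
  · intro h
    have hle := D.norm_faceForm_le hγ θ G a b (proj (D.k a b).twoK G a b (D.ket θ a b))
    have hle' : ‖proj (D.k a b).twoK G a b (D.ket θ a b)‖ ≤ ‖D.ket θ a b‖ :=
      norm_spectralProjector_le (W := V (D.k a b).twoK) _ _ _
    have hP : proj (D.k a b).twoK G a b (D.ket θ a b) = D.ket θ a b := by
      refine Submodule.starProjection_eq_self_iff.2 ?_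
      rw [Submodule.mem_iff_norm_starProjection]
      have h1 := D.norm_ket θ a b
      exact le_antisymm hle' (by rw [h1, ← h]; exact hle)
    have hO : D.FaceOriented G a b := by
      rw [← D.norm_faceForm_ket_eq_one_iff hγ θ, ← h, hP]
    refine ⟨hO, ?_⟩
    by_contra hneg
    have hP0 : proj (D.k a b).twoK G a b (D.ket θ a b) = 0 := by
      refine spectralProjector_apply_of_notMem (W := V (D.k a b).twoK) (dotL_isSymmetric _ _) ?_
        (hO.dotL_ket θ)
      rw [Set.mem_Ioi, not_lt]
      exact mul_nonpos_of_nonpos_of_nonneg (not_lt.1 hneg) (by positivity)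
    have h1 := D.norm_ket θ a b
    rw [← hP, hP0, norm_zero] at h1
    exact zero_ne_one h1
  · rintro ⟨hO, hpos⟩
    rw [hO.proj_ket_of_pos θ hpos]
    exact (D.norm_faceForm_ket_eq_one_iff hγ θ G a b).2 hO

theorem norm_expAction (G : Fin 5 → Spin4) :
    1 ≤ ‖D.expAction hγ θ G‖ ↔ ∀ a b, a < b → ‖D.faceFactor hγ θ G a b‖ = 1 := by
  have hle : ∀ a b, ‖D.faceFactor hγ θ G a b‖ ≤ 1 := D.norm_faceFactor_le_one hγ θ G
  rw [expAction, Finset.prod_sigma', norm_prod]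
  constructor
  · intro h a b hab
    by_contra hne
    have hlt : ‖D.faceFactor hγ θ G a b‖ < 1 := lt_of_le_of_ne (hle a b) hne
    have hm : (⟨a, b⟩ : Σ _ : Fin 5, Fin 5) ∈ Finset.univ.sigma fun a : Fin 5 => Finset.Ioi a := by
      simp [hab]
    rw [← Finset.mul_prod_erase _ _ hm] at h
    have h2 : ∏ x ∈ (Finset.univ.sigma fun a : Fin 5 => Finset.Ioi a).erase ⟨a, b⟩,
        ‖D.faceFactor hγ θ G x.1 x.2‖ ≤ 1 :=
      Finset.prod_le_one (fun _ _ => norm_nonneg _) fun _ _ => hle _ _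
    have h3 := mul_le_mul_of_nonneg_left h2 (norm_nonneg (D.faceFactor hγ θ G a b))
    simp only at h
    linarith
  · intro h
    refine le_of_eq (Finset.prod_eq_one fun x hx => ?_).symm
    exact h _ _ (by simpa using hx)

/-- The action has nonnegative real part exactly at the oriented and properly oriented points. -/
theorem one_le_norm_expAction_iff (G : Fin 5 → Spin4) :
    1 ≤ ‖D.expAction hγ θ G‖ ↔ D.Orientation G ∧ D.ProperOrientation G := by
  rw [norm_expAction]
  simp only [norm_faceFactor_eq_one_iff]
  constructor
  · intro h
    refine ⟨fun a b hab => ?_, fun a b hab => (h a b hab).2⟩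
    rcases lt_or_gt_of_ne hab with h1 | h1
    · exact (h a b h1).1
    · obtain ⟨h2, h3⟩ := (h b a h1).1
      exact ⟨by rw [h2, neg_neg], by rw [h3, neg_neg]⟩
  · rintro ⟨h1, h2⟩ a b hab
    exact ⟨h1 a b hab.ne, h2 a b hab⟩

end BoundaryData

/-! ### Differentiation of curves of matrices -/

/-- `F` has the derivative `F'` at parameter `0`, entry by entry. -/
def HasEntryDeriv (F : ℝ → Matrix (Fin 2) (Fin 2) ℂ) (F' : Matrix (Fin 2) (Fin 2) ℂ) : Prop :=
  ∀ i j, HasDerivAt (fun t => F t i j) (F' i j) 0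

theorem HasEntryDeriv.const (M : Matrix (Fin 2) (Fin 2) ℂ) : HasEntryDeriv (fun _ => M) 0 :=
  fun i j => hasDerivAt_const 0 (M i j)

theorem HasEntryDeriv.mul {F H : ℝ → Matrix (Fin 2) (Fin 2) ℂ} {F' H' : Matrix (Fin 2) (Fin 2) ℂ}
    (hF : HasEntryDeriv F F') (hH : HasEntryDeriv H H') :
    HasEntryDeriv (fun t => F t * H t) (F' * H 0 + F 0 * H') := by
  intro i j
  simp only [Matrix.mul_apply, Matrix.add_apply, ← Finset.sum_add_distrib]
  exact HasDerivAt.fun_sum fun k _ => (hF i k).fun_mul (hH k j)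

theorem HasEntryDeriv.conjTranspose {F : ℝ → Matrix (Fin 2) (Fin 2) ℂ}
    {F' : Matrix (Fin 2) (Fin 2) ℂ} (hF : HasEntryDeriv F F') :
    HasEntryDeriv (fun t => (F t)ᴴ) F'ᴴ := fun i j => (hF j i).star

theorem HasEntryDeriv.trTau {F : ℝ → Matrix (Fin 2) (Fin 2) ℂ}
    {F' : Matrix (Fin 2) (Fin 2) ℂ} (hF : HasEntryDeriv F F') (i : Fin 3) :
    HasDerivAt (fun t => trTau (F t) i) (ProperEPRL.trTau F' i) 0 := by
  have h := ((HasEntryDeriv.const (tau i)).mul hF)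
  have h2 : HasDerivAt (fun t => (tau i * F t).trace) (tau i * F').trace 0 := by
    simp only [Matrix.trace_fin_two]
    have h0 := h 0 0
    have h1 := h 1 1
    simp only [zero_mul, zero_add] at h0 h1
    exact h0.fun_add h1
  exact (Complex.reCLM.hasFDerivAt.comp_hasDerivAt (0 : ℝ) h2)

/-- The left-trivialised velocity `X(0)⁻¹ X'(0)` of a curve in `SU(2)` lies in `su(2)`. -/
theorem velocity_mem_su2 {X : ℝ → SU2} {A : Matrix (Fin 2) (Fin 2) ℂ}
    (h : HasEntryDeriv (fun t => (X t).1) A) :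
    (((X 0).1)ᴴ * A)ᴴ = -(((X 0).1)ᴴ * A) ∧ (((X 0).1)ᴴ * A).trace = 0 := by
  constructor
  · have h1 := h.conjTranspose.mul h
    simp only [SU2.conjTranspose_mul] at h1
    have h2 : Aᴴ * (X 0).1 + ((X 0).1)ᴴ * A = 0 := by
      ext i j
      exact (h1 i j).unique (hasDerivAt_const 0 _)
    rw [Matrix.conjTranspose_mul, Matrix.conjTranspose_conjTranspose]
    exact eq_neg_of_add_eq_zero_left h2
  · have h1 := (HasEntryDeriv.const ((X 0).1)ᴴ).mul h
    simp only [zero_mul, zero_add] at h1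
    set Y : ℝ → Matrix (Fin 2) (Fin 2) ℂ := fun t => ((X 0).1)ᴴ * (X t).1 with hY
    have hY0 : Y 0 = 1 := SU2.conjTranspose_mul _
    have hdet : ∀ t, Y t 0 0 * Y t 1 1 - Y t 0 1 * Y t 1 0 = 1 := by
      intro t
      rw [← Matrix.det_fin_two]
      exact (Matrix.mem_specialUnitaryGroup_iff.1 ((X 0)⁻¹ * X t).2).2
    have h2 := ((h1 0 0).fun_mul (h1 1 1)).fun_sub ((h1 0 1).fun_mul (h1 1 0))
    change HasDerivAt (fun t => Y t 0 0 * Y t 1 1 - Y t 0 1 * Y t 1 0)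
      (_ * Y 0 1 1 + Y 0 0 0 * _ - (_ * Y 0 1 0 + Y 0 0 1 * _)) 0 at h2
    simp only [hdet, hY0] at h2
    have h3 := h2.unique (hasDerivAt_const 0 _)
    simp only [Matrix.one_apply_eq, mul_one, one_mul, ne_eq, one_ne_zero, not_false_eq_true,
      Matrix.one_apply_ne, zero_ne_one, mul_zero, zero_mul, add_zero, sub_zero] at h3
    rw [Matrix.trace_fin_two]
    exact h3

/-- The expectation value of a traceless matrix in the spinor `U e₀`. -/
theorem conj_frame_zero_zero {v : Fin 3 → ℝ} {U : SU2} (hU : IsFrame v U)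
    {ξ : Matrix (Fin 2) (Fin 2) ℂ} (hξ : ξ.trace = 0) :
    ((U.1)ᴴ * ξ * U.1) 0 0 = Complex.I * (ξ * suVec v).trace ∧
      ((U.1)ᴴ * ξ * U.1) 1 1 = -(Complex.I * (ξ * suVec v).trace) := by
  set η := (U.1)ᴴ * ξ * U.1 with hη
  have htr : η 0 0 + η 1 1 = 0 := by
    rw [← Matrix.trace_fin_two, hη, Matrix.trace_mul_comm, ← mul_assoc, SU2.mul_conjTranspose,
      one_mul, hξ]
  have h1 : Complex.I * (ξ * suVec v).trace = (η * !![1 / 2, 0; 0, -1 / 2]).trace := by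
    have h2 := isFrame_iff_adj.1 hU
    rw [← smul_eq_mul, ← Matrix.trace_smul, ← Matrix.mul_smul, h2, adj, SU2.coe_inv, hη,
      ← mul_assoc, Matrix.trace_mul_comm]
    simp only [mul_assoc]
  have h3 : (η * !![1 / 2, 0; 0, -1 / 2]).trace = η 0 0 * (1 / 2) + η 1 1 * (-1 / 2) := by
    simp [Matrix.trace_fin_two, Matrix.mul_apply, Fin.sum_univ_two]
  constructor
  · linear_combination (1 / 2 : ℂ) * htr - h1 - h3
  · linear_combination (1 / 2 : ℂ) * htr + h1 + h3

namespace BoundaryData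

variable (D : BoundaryData γ) (hγ : γ ∈ Set.Ioo (0 : ℝ) 1) (θ : Fin 5 → Fin 5 → ℝ)

/-- The logarithmic derivative of a spin-`1/2` face amplitude at an oriented configuration. -/
theorem hasDerivAt_frameRel {X : ℝ → Fin 5 → SU2} {A : Fin 5 → Matrix (Fin 2) (Fin 2) ℂ}
    (hX : ∀ a, HasEntryDeriv (fun t => (X t a).1) (A a)) {a b : Fin 5}
    (h0 : (D.frameRel (X 0) a b).1 0 0 = 0) :
    HasDerivAt (fun t => (D.frameRel (X t) a b).1 1 0)
      ((D.frameRel (X 0) a b).1 1 0 *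
        (Complex.I * ((((X 0 a).1)ᴴ * A a) * suVec (D.n a b).1).trace +
          Complex.I * ((((X 0 b).1)ᴴ * A b) * suVec (D.n b a).1).trace)) 0 := by
  have hW := (((HasEntryDeriv.const ((frame (D.n a b)).1)ᴴ).mul
    ((hX a).conjTranspose.mul (hX b))).mul (HasEntryDeriv.const (frame (D.n b a)).1)) 1 0
  refine hW.congr_deriv ?_
  simp only [zero_mul, zero_add, mul_zero, add_zero]
  obtain ⟨ha1, ha2⟩ := velocity_mem_su2 (X := fun t => X t a) (hX a)
  obtain ⟨-, hb2⟩ := velocity_mem_su2 (X := fun t => X t b) (hX b)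
  obtain ⟨-, hη⟩ := conj_frame_zero_zero (isFrame_frame (D.n a b)) ha2
  obtain ⟨hη', -⟩ := conj_frame_zero_zero (isFrame_frame (D.n b a)) hb2
  set U := frame (D.n a b)
  set Y := frame (D.n b a)
  set ξ := ((X 0 a).1)ᴴ * A a with hξ
  set ξ' := ((X 0 b).1)ᴴ * A b with hξ'
  set W := D.frameRel (X 0) a b with hWdef
  have hWval : W.1 = (U.1)ᴴ * (((X 0 a).1)ᴴ * (X 0 b).1) * Y.1 := rfl
  have hA : (A a)ᴴ = -ξ * ((X 0 a).1)ᴴ := by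
    rw [← ha1, hξ, Matrix.conjTranspose_mul, Matrix.conjTranspose_conjTranspose, mul_assoc,
      SU2.mul_conjTranspose, mul_one]
  have hB : A b = (X 0 b).1 * ξ' := by
    rw [hξ', ← mul_assoc, SU2.mul_conjTranspose, one_mul]
  have key : (U.1)ᴴ * ((A a)ᴴ * (X 0 b).1 + ((X 0 a).1)ᴴ * A b) * Y.1 =
      -(((U.1)ᴴ * ξ * U.1) * W.1) + W.1 * ((Y.1)ᴴ * ξ' * Y.1) := by
    have e1 : ∀ Z, U.1 * ((U.1)ᴴ * Z) = Z := fun Z => by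
      rw [← mul_assoc, SU2.mul_conjTranspose, one_mul]
    have e2 : ∀ Z, Y.1 * ((Y.1)ᴴ * Z) = Z := fun Z => by
      rw [← mul_assoc, SU2.mul_conjTranspose, one_mul]
    rw [hA, hB, hWval]
    simp only [mul_assoc, mul_add, add_mul, neg_mul, mul_neg, e1, e2]
  have h11 : W.1 1 1 = 0 := by rw [(su2_entries W).1, h0, star_zero]
  rw [key, Matrix.add_apply, Matrix.neg_apply, Matrix.mul_apply, Matrix.mul_apply,
    Fin.sum_univ_two, Fin.sum_univ_two, hη, hη', h0, h11]
  ring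

/-- The logarithmic derivative of a face amplitude at an oriented face, for velocities
`ξ⁻, ξ⁺` in `su(2)`. -/
def logDeriv (ξm ξp : Fin 5 → Matrix (Fin 2) (Fin 2) ℂ) (a b : Fin 5) : ℂ :=
  (D.k a b).twoSm * (Complex.I * (ξm a * suVec (D.n a b).1).trace +
      Complex.I * (ξm b * suVec (D.n b a).1).trace) +
    (D.k a b).twoSp * (Complex.I * (ξp a * suVec (D.n a b).1).trace +
      Complex.I * (ξp b * suVec (D.n b a).1).trace)

theorem hasDerivAt_faceForm {c : ℝ → Fin 5 → Spin4} {A B : Fin 5 → Matrix (Fin 2) (Fin 2) ℂ}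
    (hA : ∀ a, HasEntryDeriv (fun t => (c t a).1.1) (A a))
    (hB : ∀ a, HasEntryDeriv (fun t => (c t a).2.1) (B a)) {a b : Fin 5}
    (h0 : D.FaceOriented (c 0) a b) :
    HasDerivAt (fun t => D.faceForm hγ θ (c t) a b (D.ket θ a b))
      (D.faceForm hγ θ (c 0) a b (D.ket θ a b) *
        D.logDeriv (fun a => ((c 0 a).1.1)ᴴ * A a) (fun a => ((c 0 a).2.1)ᴴ * B a) a b) 0 := by
  obtain ⟨C, -, hC⟩ := D.exists_faceForm_ket hγ θ a b
  obtain ⟨hm, hp⟩ := (D.faceOriented_iff_frameRel (c 0) a b).1 h0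
  have dm := (D.hasDerivAt_frameRel (X := fun t a => (c t a).1) hA hm).fun_pow (D.k a b).twoSm
  have dp := (D.hasDerivAt_frameRel (X := fun t a => (c t a).2) hB hp).fun_pow (D.k a b).twoSp
  have h := (dm.const_mul C).fun_mul dp
  simp only [hC]
  refine h.congr_deriv ?_
  obtain ⟨M, hM⟩ := Nat.exists_eq_succ_of_ne_zero ((D.k a b).twoSm_pos hγ).ne'
  obtain ⟨N, hN⟩ := Nat.exists_eq_succ_of_ne_zero ((D.k a b).twoSp_pos hγ).ne'
  rw [logDeriv, hM, hN]
  simp only [Nat.succ_eq_add_one, Nat.add_sub_cancel, pow_succ]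
  ring

end BoundaryData

/-! ### The projector near a properly oriented face -/

/-- The functional `⟨u, ·⟩` is close to a multiple of `⟨y, ·⟩` when `|⟨u, y⟩|` is close to `1`. -/
theorem norm_inner_le_of_unit {F : Type*} [NormedAddCommGroup F] [InnerProductSpace ℂ F] {u y : F}
    (hu : ‖u‖ = 1) (hy : ‖y‖ = 1) (x : F) :
    ‖inner ℂ u x‖ ≤ ‖inner ℂ y x‖ + √(1 - ‖inner ℂ u y‖ ^ 2) * ‖x‖ := by
  set w := u - inner ℂ y u • y with hw
  have h1 : inner ℂ u x = inner ℂ u y * inner ℂ y x + inner ℂ w x := by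
    rw [hw, inner_sub_left, inner_smul_left, inner_conj_symm]
    ring
  have hyw : inner ℂ y w = 0 := by
    rw [hw, inner_sub_right, inner_smul_right, inner_self_eq_norm_sq_to_K, hy]
    simp
  have hnw : ‖w‖ ^ 2 = 1 - ‖inner ℂ u y‖ ^ 2 := by
    have hu' : u = inner ℂ y u • y + w := by rw [hw]; abel
    have h2 := norm_add_sq_eq_norm_sq_add_norm_sq_of_inner_eq_zero (𝕜 := ℂ) (inner ℂ y u • y) w
      (by rw [inner_smul_left, hyw, mul_zero])
    rw [← hu', hu, norm_smul, hy, mul_one, norm_inner_symm] at h2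
    nlinarith
  have hnw' : ‖w‖ = √(1 - ‖inner ℂ u y‖ ^ 2) := by
    rw [← hnw, Real.sqrt_sq (norm_nonneg _)]
  have h3 : ‖inner ℂ u y‖ ≤ 1 := by
    have := norm_inner_le_norm (𝕜 := ℂ) u y
    rwa [hu, hy, one_mul] at this
  calc ‖inner ℂ u x‖ ≤ ‖inner ℂ u y‖ * ‖inner ℂ y x‖ + ‖inner ℂ w x‖ := by
        rw [h1]
        exact (norm_add_le _ _).trans_eq (by rw [norm_mul])
    _ ≤ 1 * ‖inner ℂ y x‖ + ‖w‖ * ‖x‖ :=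
        add_le_add (mul_le_mul_of_nonneg_right h3 (norm_nonneg _)) (norm_inner_le_norm _ _)
    _ = _ := by rw [one_mul, hnw']

theorem norm_inner_sub_spectralProjector {W : Type*} [NormedAddCommGroup W]
    [InnerProductSpace ℂ W] [FiniteDimensional ℂ W] (S : Set ℝ) (T : W →ₗ[ℂ] W) (ψ : W) :
    ‖inner ℂ ψ (ψ - spectralProjector S T ψ)‖ = ‖ψ - spectralProjector S T ψ‖ ^ 2 := by
  set p := spectralProjector S T ψ with hp
  have h : inner ℂ p (ψ - p) = 0 :=
    (Submodule.mem_orthogonal _ _).1 (Submodule.sub_starProjection_mem_orthogonal ψ) _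
      (Submodule.starProjection_apply_mem _ ψ)
  have h2 : inner ℂ ψ (ψ - p) = inner ℂ (ψ - p) (ψ - p) := by
    rw [inner_sub_left ψ p (ψ - p), h, sub_zero]
  rw [h2, inner_self_eq_norm_sq_to_K]
  simp

namespace BoundaryData

variable (D : BoundaryData γ) (hγ : γ ∈ Set.Ioo (0 : ℝ) 1) (θ : Fin 5 → Fin 5 → ℝ)

/-- Near a properly oriented face the projector changes the face factor by terms of second order: it
nearly fixes `|n_{ba}⟩`, and what it removes is nearly orthogonal to the vector it is paired with. -/
theorem exists_norm_faceFactor_sub_le {G : Fin 5 → Spin4} {a b : Fin 5}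
    (hO : D.FaceOriented G a b) (hpos : 0 < ∑ i, axis G a b i * (D.n b a).1 i) :
    ∃ C : Fin 3 → ℝ, ∀ H : Fin 5 → Spin4,
      ‖D.faceFactor hγ θ H a b - D.faceForm hγ θ H a b (D.ket θ a b)‖ ≤
        (∑ i, C i * ‖axis H a b i - axis G a b i‖ +
          √(1 - ‖D.faceForm hγ θ H a b (D.ket θ a b)‖ ^ 2)) *
        ∑ i, C i * ‖axis H a b i - axis G a b i‖ := by
  set l : ℝ := (∑ i, axis G a b i * (D.n b a).1 i) * ((D.k a b).twoK / 2) with hl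
  have hlpos : 0 < l := by
    have := (D.k a b).pos
    positivity
  set ψ := D.ket θ a b with hψ
  refine ⟨fun i => l⁻¹ * ‖Lhat (D.k a b).twoK i ψ‖, fun H => ?_⟩
  set Q := ψ - proj (D.k a b).twoK H a b ψ with hQ
  set q := ∑ i, l⁻¹ * ‖Lhat (D.k a b).twoK i ψ‖ * ‖axis H a b i - axis G a b i‖ with hq
  have hQq : ‖Q‖ ≤ q := by
    have h1 : l * ‖Q‖ ≤ ‖dotL (D.k a b).twoK (axis H a b) ψ - (l : ℂ) • ψ‖ :=
      mul_norm_sub_spectralProjector_le (W := V (D.k a b).twoK) (dotL_isSymmetric _ _) l ψ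
    rw [← hO.dotL_ket θ] at h1
    have h2 := h1.trans (norm_dotL_sub_le _ _ _ _)
    have h3 : ‖Q‖ ≤ l⁻¹ * ∑ i, ‖axis H a b i - axis G a b i‖ * ‖Lhat (D.k a b).twoK i ψ‖ := by
      rw [← mul_le_mul_iff_right₀ hlpos, mul_inv_cancel_left₀ hlpos.ne']
      exact h2
    refine h3.trans_eq ?_
    rw [hq, Finset.mul_sum]
    exact Finset.sum_congr rfl fun i _ => by ring
  have hdiff : D.faceFactor hγ θ H a b - D.faceForm hγ θ H a b ψ = -D.faceForm hγ θ H a b Q := by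
    rw [faceFactor_eq_faceForm, hQ, faceForm_sub]
    ring
  have hy : ‖rhoIota ((D.k a b).add_eq hγ) (rel H a b) ψ‖ = 1 := by
    rw [norm_rhoIota]
    exact D.norm_ket θ a b
  have h4 := norm_inner_le_of_unit (D.norm_bra hγ θ a b) hy
    (rhoIota ((D.k a b).add_eq hγ) (rel H a b) Q)
  have h5 : ‖inner ℂ ψ Q‖ = ‖Q‖ ^ 2 :=
    norm_inner_sub_spectralProjector (W := V (D.k a b).twoK) _ _ ψ
  have h9 : ‖inner ℂ (rhoIota ((D.k a b).add_eq hγ) (rel H a b) ψ)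
      (rhoIota ((D.k a b).add_eq hγ) (rel H a b) Q)‖ = ‖Q‖ ^ 2 := by
    rw [← h5, inner_rhoIota]
  rw [norm_rhoIota, h9] at h4
  rw [hdiff, norm_neg]
  have h6 : ‖D.faceForm hγ θ H a b Q‖ ≤
      ‖Q‖ ^ 2 + √(1 - ‖D.faceForm hγ θ H a b ψ‖ ^ 2) * ‖Q‖ := h4
  have h7 := Real.sqrt_nonneg (1 - ‖D.faceForm hγ θ H a b ψ‖ ^ 2)
  have h8 : 0 ≤ ‖Q‖ := norm_nonneg _
  refine h6.trans ?_
  rw [sq, ← add_mul]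
  exact mul_le_mul (add_le_add hQq le_rfl) hQq h8 (add_nonneg (h8.trans hQq) h7)

end BoundaryData

/-! ### Continuity in the group elements -/

theorem continuous_coe_fst (a : Fin 5) : Continuous fun G : Fin 5 → Spin4 => (G a).1.1 :=
  continuous_subtype_val.comp (continuous_fst.comp (continuous_apply a))

theorem continuous_coe_snd (a : Fin 5) : Continuous fun G : Fin 5 → Spin4 => (G a).2.1 :=
  continuous_subtype_val.comp (continuous_snd.comp (continuous_apply a))

theorem continuous_rel_fst (a b : Fin 5) :
    Continuous fun G : Fin 5 → Spin4 => (rel G a b).1.1 :=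
  (continuous_coe_fst a).matrix_conjTranspose.matrix_mul (continuous_coe_fst b)

theorem continuous_rel_snd (a b : Fin 5) :
    Continuous fun G : Fin 5 → Spin4 => (rel G a b).2.1 :=
  (continuous_coe_snd a).matrix_conjTranspose.matrix_mul (continuous_coe_snd b)

theorem continuous_trTau (i : Fin 3) : Continuous fun M => trTau M i :=
  Complex.continuous_re.comp (continuous_const.matrix_mul continuous_id).matrix_trace

theorem continuous_spatialN (a b : Fin 5) (i : Fin 3) : Continuous fun G => spatialN G a b i := by
  have h : ∀ G, spatialN G a b i =
      trTau ((rel G a b).1.1 * zeta refN * ((rel G a b).2.1)ᴴ) i := fun G => rfl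
  simp only [h]
  exact (continuous_trTau i).comp (((continuous_rel_fst a b).matrix_mul continuous_const).matrix_mul
    (continuous_rel_snd a b).matrix_conjTranspose)

theorem continuous_det_spatialN (a : Fin 5) (f : Fin 3 → Fin 5) :
    Continuous fun G => Matrix.det (Matrix.of fun i : Fin 3 => spatialN G a (f i)) :=
  Continuous.matrix_det (continuous_matrix fun i j => continuous_spatialN a (f i) j)

/-- `β_{ab}` is locally constant where it does not vanish. -/
theorem eventually_beta_eq {G : Fin 5 → Spin4} {a b : Fin 5} (h : beta G a b ≠ 0) :
    ∀ᶠ H in nhds G, beta H a b = beta G a b := by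
  set f : (Fin 5 → Spin4) → ℝ := fun H => tripleN H a b *
    Matrix.det (Matrix.of fun i : Fin 3 => spatialN H b (others a b i)) with hf
  have hc : ContinuousAt f G :=
    ((continuous_det_spatialN a (others a b)).mul
      (continuous_det_spatialN b (others a b))).continuousAt
  have hb : ∀ H, beta H a b = -Real.sign (f H) := fun H => rfl
  simp only [hb] at h ⊢
  have h0 : f G ≠ 0 := fun h0 => h (by rw [h0, Real.sign_zero, neg_zero])
  rcases lt_or_gt_of_ne h0 with h1 | h1
  · filter_upwards [hc.eventually_lt continuousAt_const h1] with H hH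
    rw [Real.sign_of_neg hH, Real.sign_of_neg h1]
  · filter_upwards [continuousAt_const.eventually_lt hc h1] with H hH
    rw [Real.sign_of_pos hH, Real.sign_of_pos h1]

theorem continuous_trTau_rel (a b : Fin 5) (i : Fin 3) :
    Continuous fun G : Fin 5 → Spin4 => trTau ((rel G b a).1 * (rel G a b).2 : SU2).1 i :=
  (continuous_trTau i).comp ((continuous_rel_fst b a).matrix_mul (continuous_rel_snd a b))

theorem beta_ne_zero_of_pos {G : Fin 5 → Spin4} {a b : Fin 5} {n : Fin 3 → ℝ}
    (h : 0 < ∑ i, axis G a b i * n i) : beta G a b ≠ 0 := by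
  intro h0
  simp [axis, h0] at h

theorem continuousAt_axis {G : Fin 5 → Spin4} {a b : Fin 5} (h : beta G a b ≠ 0) (i : Fin 3) :
    ContinuousAt (fun H => axis H a b i) G := by
  refine (((continuous_trTau_rel a b i).continuousAt).const_mul (beta G a b)).congr ?_
  filter_upwards [eventually_beta_eq h] with H hH
  rw [axis, hH]

theorem IsVariation.tendsto {G : Fin 5 → Spin4} {c : ℝ → Fin 5 → Spin4} (hc : IsVariation G c) :
    Filter.Tendsto c (nhds 0) (nhds G) := by
  obtain ⟨rfl, h⟩ := hc
  refine tendsto_pi_nhds.2 fun a => Filter.Tendsto.prodMk_nhds ?_ ?_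
  · exact tendsto_subtype_rng.2 <| tendsto_pi_nhds.2 fun i => tendsto_pi_nhds.2 fun j =>
      (h a i j).1.continuousAt.tendsto
  · exact tendsto_subtype_rng.2 <| tendsto_pi_nhds.2 fun i => tendsto_pi_nhds.2 fun j =>
      (h a i j).2.continuousAt.tendsto

theorem IsVariation.exists_hasEntryDeriv {G : Fin 5 → Spin4} {c : ℝ → Fin 5 → Spin4}
    (hc : IsVariation G c) : ∃ A B : Fin 5 → Matrix (Fin 2) (Fin 2) ℂ,
      (∀ a, HasEntryDeriv (fun t => (c t a).1.1) (A a)) ∧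
        ∀ a, HasEntryDeriv (fun t => (c t a).2.1) (B a) :=
  ⟨fun a => Matrix.of fun i j => deriv (fun t => (c t a).1.1 i j) 0,
    fun a => Matrix.of fun i j => deriv (fun t => (c t a).2.1 i j) 0,
    fun a i j => (hc.2 a i j).1.hasDerivAt, fun a i j => (hc.2 a i j).2.hasDerivAt⟩

theorem IsVariation.differentiableAt_axis {G : Fin 5 → Spin4} {c : ℝ → Fin 5 → Spin4}
    (hc : IsVariation G c) {a b : Fin 5} (h : beta G a b ≠ 0) (i : Fin 3) :
    DifferentiableAt ℝ (fun t => axis (c t) a b i) 0 := by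
  obtain ⟨A, B, hA, hB⟩ := hc.exists_hasEntryDeriv
  have hm := (hA b).conjTranspose.mul (hA a)
  have hp := (hB a).conjTranspose.mul (hB b)
  have hd := ((hm.mul hp).trTau i).differentiableAt.const_mul (beta G a b)
  refine hd.congr_of_eventuallyEq ?_
  filter_upwards [hc.tendsto.eventually (eventually_beta_eq h)] with t ht
  rw [axis, ht]
  rfl

/-! ### First variation of the action -/

namespace BoundaryData

variable (D : BoundaryData γ) (hγ : γ ∈ Set.Ioo (0 : ℝ) 1) (θ : Fin 5 → Fin 5 → ℝ)

theorem continuous_faceForm_ket (a b : Fin 5) :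
    Continuous fun G => D.faceForm hγ θ G a b (D.ket θ a b) := by
  obtain ⟨C, -, hC⟩ := D.exists_faceForm_ket hγ θ a b
  simp only [hC]
  have hm : Continuous fun G : Fin 5 → Spin4 => (D.frameRel (fun c => (G c).1) a b).1 1 0 :=
    ((continuous_const.matrix_mul (continuous_rel_fst a b)).matrix_mul
      (continuous_const (y := (frame (D.n b a)).1))).matrix_elem 1 0
  have hp : Continuous fun G : Fin 5 → Spin4 => (D.frameRel (fun c => (G c).2) a b).1 1 0 :=
    ((continuous_const.matrix_mul (continuous_rel_snd a b)).matrix_mul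
      (continuous_const (y := (frame (D.n b a)).1))).matrix_elem 1 0
  exact (continuous_const.mul (hm.pow _)).mul (hp.pow _)

theorem continuousAt_faceFactor {G : Fin 5 → Spin4} {a b : Fin 5}
    (hO : D.FaceOriented G a b) (hpos : 0 < ∑ i, axis G a b i * (D.n b a).1 i) :
    ContinuousAt (fun H => D.faceFactor hγ θ H a b) G := by
  obtain ⟨C, hC⟩ := D.exists_norm_faceFactor_sub_le hγ θ hO hpos
  have hβ := beta_ne_zero_of_pos hpos
  have hℓ := (D.continuous_faceForm_ket hγ θ a b).continuousAt (x := G)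
  have hq : ContinuousAt (fun H => ∑ i, C i * ‖axis H a b i - axis G a b i‖) G :=
    tendsto_finsetSum _ fun i _ =>
      (((continuousAt_axis hβ i).sub continuousAt_const).norm).const_mul (C i)
  have hs : ContinuousAt (fun H => √(1 - ‖D.faceForm hγ θ H a b (D.ket θ a b)‖ ^ 2)) G :=
    (continuousAt_const.sub (hℓ.norm.pow 2)).sqrt
  have hb := (hq.add hs).mul hq
  have hr : Filter.Tendsto (fun H => D.faceFactor hγ θ H a b -
      D.faceForm hγ θ H a b (D.ket θ a b)) (nhds G) (nhds 0) := by
    refine squeeze_zero_norm hC ?_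
    have h0 : (∑ i, C i * ‖axis G a b i - axis G a b i‖ +
        √(1 - ‖D.faceForm hγ θ G a b (D.ket θ a b)‖ ^ 2)) *
        ∑ i, C i * ‖axis G a b i - axis G a b i‖ = 0 := by simp
    rw [← h0]
    exact hb
  have hsum := hr.add hℓ
  simp only [sub_add_cancel, zero_add] at hsum
  have hG : D.faceFactor hγ θ G a b = D.faceForm hγ θ G a b (D.ket θ a b) := by
    rw [faceFactor_eq_faceForm, hO.proj_ket_of_pos θ hpos]
  rw [ContinuousAt, hG]
  exact hsum

theorem hasDerivAt_faceFactor {c : ℝ → Fin 5 → Spin4} (hc : IsVariation (c 0) c)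
    {A B : Fin 5 → Matrix (Fin 2) (Fin 2) ℂ}
    (hA : ∀ a, HasEntryDeriv (fun t => (c t a).1.1) (A a))
    (hB : ∀ a, HasEntryDeriv (fun t => (c t a).2.1) (B a)) {a b : Fin 5}
    (hO : D.FaceOriented (c 0) a b) (hpos : 0 < ∑ i, axis (c 0) a b i * (D.n b a).1 i) :
    HasDerivAt (fun t => D.faceFactor hγ θ (c t) a b) (D.faceFactor hγ θ (c 0) a b *
      D.logDeriv (fun a => ((c 0 a).1.1)ᴴ * A a) (fun a => ((c 0 a).2.1)ᴴ * B a) a b) 0 := by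
  obtain ⟨C, hC⟩ := D.exists_norm_faceFactor_sub_le hγ θ hO hpos
  have hβ := beta_ne_zero_of_pos hpos
  have hℓ := D.hasDerivAt_faceForm hγ θ hA hB hO
  have hG : D.faceFactor hγ θ (c 0) a b = D.faceForm hγ θ (c 0) a b (D.ket θ a b) := by
    rw [faceFactor_eq_faceForm, hO.proj_ket_of_pos θ hpos]
  -- The contribution of the projector is `o(t) = o(1) O(t)`.
  have hr : HasDerivAt (fun t => D.faceFactor hγ θ (c t) a b -
      D.faceForm hγ θ (c t) a b (D.ket θ a b)) 0 0 := by
    have hqO : (fun t => ∑ i, C i * ‖axis (c t) a b i - axis (c 0) a b i‖) =O[nhds 0]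
        fun t : ℝ => t := by
      refine Asymptotics.IsBigO.fun_sum fun i _ => Asymptotics.IsBigO.const_mul_left ?_ _
      have h := (hc.differentiableAt_axis hβ i).isBigO_sub
      simp only [sub_zero] at h
      exact h.norm_left
    have hq0 : Filter.Tendsto (fun t => ∑ i, C i * ‖axis (c t) a b i - axis (c 0) a b i‖)
        (nhds 0) (nhds 0) := hqO.trans_tendsto Filter.tendsto_id
    have hs0 : Filter.Tendsto (fun t => √(1 - ‖D.faceForm hγ θ (c t) a b (D.ket θ a b)‖ ^ 2))
        (nhds 0) (nhds 0) := by
      have h := (continuousAt_const (y := (1 : ℝ))).sub (hℓ.continuousAt.norm.pow 2) |>.sqrt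
      have h1 := (D.norm_faceForm_ket_eq_one_iff hγ θ (c 0) a b).2 hO
      rw [ContinuousAt] at h
      simpa [h1] using h
    have ho : (fun t => (∑ i, C i * ‖axis (c t) a b i - axis (c 0) a b i‖ +
        √(1 - ‖D.faceForm hγ θ (c t) a b (D.ket θ a b)‖ ^ 2)) *
        ∑ i, C i * ‖axis (c t) a b i - axis (c 0) a b i‖) =o[nhds 0] fun t : ℝ => t := by
      have h1 : (fun t => ∑ i, C i * ‖axis (c t) a b i - axis (c 0) a b i‖ +
          √(1 - ‖D.faceForm hγ θ (c t) a b (D.ket θ a b)‖ ^ 2)) =o[nhds 0]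
          fun _ : ℝ => (1 : ℝ) := by
        rw [Asymptotics.isLittleO_one_iff]
        simpa using hq0.add hs0
      simpa using h1.mul_isBigO hqO
    rw [hasDerivAt_iff_isLittleO]
    simp only [hG, sub_self, sub_zero, smul_zero]
    refine Asymptotics.IsBigO.trans_isLittleO (Asymptotics.IsBigO.of_bound 1 ?_) ho
    refine Filter.Eventually.of_forall fun t => ?_
    rw [one_mul]
    exact (hC (c t)).trans (le_abs_self _)
  have hsum := hr.fun_add hℓ
  simp only [sub_add_cancel, zero_add] at hsum
  rw [hG]
  exact hsum

end BoundaryData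

theorem hasDerivAt_prod_of_logDeriv {ι : Type*} (s : Finset ι) {f : ι → ℝ → ℂ} {L : ι → ℂ}
    {x : ℝ} (h : ∀ i ∈ s, HasDerivAt (f i) (f i x * L i) x) :
    HasDerivAt (fun t => ∏ i ∈ s, f i t) ((∏ i ∈ s, f i x) * ∑ i ∈ s, L i) x := by
  classical
  induction s using Finset.induction_on with
  | empty => simpa using hasDerivAt_const x (1 : ℂ)
  | insert i s hi ih =>
    have h1 := (h i (Finset.mem_insert_self i s)).fun_mul
      (ih fun j hj => h j (Finset.mem_insert_of_mem hj))
    simp only [Finset.prod_insert hi, Finset.sum_insert hi]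
    exact h1.congr_deriv (by ring)

/-- A sum over unordered pairs, symmetrised. -/
theorem sum_Ioi_add_swap (F : Fin 5 → Fin 5 → ℂ) :
    ∑ a, ∑ b ∈ Finset.Ioi a, (F a b + F b a) = ∑ a, ∑ b ∈ Finset.univ.erase a, F a b := by
  have h1 : ∑ a, ∑ b ∈ Finset.Ioi a, F b a = ∑ a, ∑ b ∈ Finset.Iio a, F a b :=
    Finset.sum_comm' fun a b => by simp
  simp only [Finset.sum_add_distrib]
  rw [h1, ← Finset.sum_add_distrib]
  refine Finset.sum_congr rfl fun a _ => ?_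
  rw [← Finset.sum_union]
  · congr 1
    ext b
    simp [lt_or_lt_iff_ne, eq_comm]
  · exact Finset.disjoint_left.2 fun b h1 h2 =>
      lt_asymm (Finset.mem_Ioi.1 h1) (Finset.mem_Iio.1 h2)

theorem trace_mul_suVec_sum {ι : Type*} (s : Finset ι) (ξ : Matrix (Fin 2) (Fin 2) ℂ)
    (r : ι → ℝ) (v : ι → EuclideanSpace ℝ (Fin 3)) :
    (ξ * suVec (∑ i ∈ s, r i • v i : EuclideanSpace ℝ (Fin 3))).trace =
      ∑ i ∈ s, (r i : ℂ) * (ξ * suVec (v i)).trace := by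
  have h : suVec (∑ i ∈ s, r i • v i : EuclideanSpace ℝ (Fin 3)) =
      ∑ i ∈ s, (r i : ℂ) • suVec (v i) := by
    simp only [suVec, Finset.smul_sum, WithLp.ofLp_sum, Finset.sum_apply, WithLp.ofLp_smul,
      Pi.smul_apply, Complex.ofReal_sum, Finset.sum_smul, smul_eq_mul, Complex.ofReal_mul, smul_smul]
    exact Finset.sum_comm
  rw [h, Finset.mul_sum, Matrix.trace_sum]
  refine Finset.sum_congr rfl fun i _ => ?_
  rw [Matrix.mul_smul, Matrix.trace_smul, smul_eq_mul]

namespace BoundaryData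

/-- The vector `∑_{b ≠ a} k_{ab} n_{ab}`. -/
def closureVec (D : BoundaryData γ) (a : Fin 5) : EuclideanSpace ℝ (Fin 3) :=
  ∑ b ∈ Finset.univ.erase a, ((D.k a b).twoK / 2 : ℝ) • (D.n a b).1

/-- The first variation of the action, collected by tetrahedra: as `s^± ∝ k`, both chiralities see
the same closure vector. -/
theorem sum_logDeriv (D : BoundaryData γ) (hγ : γ ∈ Set.Ioo (0 : ℝ) 1)
    (ξm ξp : Fin 5 → Matrix (Fin 2) (Fin 2) ℂ) :
    ∑ a, ∑ b ∈ Finset.Ioi a, D.logDeriv ξm ξp a b =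
      Complex.I * ∑ a, ((1 - γ) * (ξm a * suVec (D.closureVec a)).trace +
        (1 + γ) * (ξp a * suVec (D.closureVec a)).trace) := by
  have hm : ∀ a b, ((D.k a b).twoSm : ℂ) = (1 - γ) * (((D.k a b).twoK / 2 : ℝ) : ℂ) := by
    intro a b
    have h := (D.k a b).sm_eq
    rw [abs_of_pos (by linarith [hγ.2])] at h
    have h2 : (((D.k a b).twoSm : ℝ) : ℂ) = (((1 - γ) / 2 * (D.k a b).twoK : ℝ) : ℂ) := by rw [h]
    push_cast at h2 ⊢
    rw [h2]
    ring
  have hp : ∀ a b, ((D.k a b).twoSp : ℂ) = (1 + γ) * (((D.k a b).twoK / 2 : ℝ) : ℂ) := by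
    intro a b
    have h := (D.k a b).sp_eq
    rw [abs_of_pos (by linarith [hγ.1])] at h
    have h2 : (((D.k a b).twoSp : ℝ) : ℂ) = (((1 + γ) / 2 * (D.k a b).twoK : ℝ) : ℂ) := by rw [h]
    push_cast at h2 ⊢
    rw [h2]
    ring
  set F : Fin 5 → Fin 5 → ℂ := fun a b => Complex.I * ((1 - γ) *
    ((((D.k a b).twoK / 2 : ℝ) : ℂ) * (ξm a * suVec (D.n a b).1).trace) + (1 + γ) *
    ((((D.k a b).twoK / 2 : ℝ) : ℂ) * (ξp a * suVec (D.n a b).1).trace)) with hF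
  have hL : ∀ a b, D.logDeriv ξm ξp a b = F a b + F b a := by
    intro a b
    rw [logDeriv, hm, hp, hF]
    simp only [D.k_symm b a]
    ring
  simp only [hL]
  rw [sum_Ioi_add_swap, Finset.mul_sum]
  refine Finset.sum_congr rfl fun a _ => ?_
  rw [closureVec, trace_mul_suVec_sum, trace_mul_suVec_sum, hF]
  simp only [← Finset.mul_sum, Finset.sum_add_distrib]

variable (D : BoundaryData γ) (hγ : γ ∈ Set.Ioo (0 : ℝ) 1) (θ : Fin 5 → Fin 5 → ℝ)

theorem hasDerivAt_expAction {c : ℝ → Fin 5 → Spin4} (hc : IsVariation (c 0) c)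
    {A B : Fin 5 → Matrix (Fin 2) (Fin 2) ℂ}
    (hA : ∀ a, HasEntryDeriv (fun t => (c t a).1.1) (A a))
    (hB : ∀ a, HasEntryDeriv (fun t => (c t a).2.1) (B a))
    (hO : D.Orientation (c 0)) (hP : D.ProperOrientation (c 0)) :
    HasDerivAt (fun t => D.expAction hγ θ (c t)) (D.expAction hγ θ (c 0) *
      (Complex.I * ∑ a, ((1 - γ) * (((c 0 a).1.1)ᴴ * A a * suVec (D.closureVec a)).trace +
        (1 + γ) * (((c 0 a).2.1)ᴴ * B a * suVec (D.closureVec a)).trace))) 0 := by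
  rw [← D.sum_logDeriv hγ (fun a => ((c 0 a).1.1)ᴴ * A a) (fun a => ((c 0 a).2.1)ᴴ * B a)]
  exact hasDerivAt_prod_of_logDeriv _ fun a _ => hasDerivAt_prod_of_logDeriv _ fun b hb =>
    D.hasDerivAt_faceFactor hγ θ hc hA hB (hO a b (Finset.mem_Ioi.1 hb).ne)
      (hP a b (Finset.mem_Ioi.1 hb))

theorem continuousAt_expAction {G : Fin 5 → Spin4} (hO : D.Orientation G)
    (hP : D.ProperOrientation G) : ContinuousAt (D.expAction hγ θ) G :=
  tendsto_finsetProd _ fun a _ => tendsto_finsetProd _ fun b hb =>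
    D.continuousAt_faceFactor hγ θ (hO a b (Finset.mem_Ioi.1 hb).ne) (hP a b (Finset.mem_Ioi.1 hb))

end BoundaryData

/-! ### Variations of a single tetrahedron -/

/-- The one-parameter subgroup `t ↦ exp(2 t τ^i)` of `SU(2)`. -/
def rot (i : Fin 3) (t : ℝ) : SU2 :=
  ⟨(Real.cos t : ℂ) • 1 + (2 * Real.sin t : ℂ) • tau i, by
    have h : (Complex.cos t) ^ 2 + (Complex.sin t) ^ 2 = 1 := by
      rw [add_comm, Complex.sin_sq_add_cos_sq]
    have hs : (starRingEnd ℂ) (Complex.sin t) = Complex.sin t := by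
      rw [← Complex.sin_conj, Complex.conj_ofReal]
    have hc : (starRingEnd ℂ) (Complex.cos t) = Complex.cos t := by
      rw [← Complex.cos_conj, Complex.conj_ofReal]
    have h2 : (starRingEnd ℂ) 2 = 2 := map_ofNat _ 2
    refine Matrix.mem_specialUnitaryGroup_iff.2 ⟨Matrix.mem_unitaryGroup_iff.2 ?_, ?_⟩
    · ext a b
      fin_cases i <;> fin_cases a <;> fin_cases b <;>
        simp [tau, pauli, Matrix.mul_apply, Matrix.star_apply, hs, hc, h2] <;>
        first
        | ring1
        | linear_combination h - (Complex.sin t) ^ 2 * Complex.I_sq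
        | linear_combination h + (Complex.sin t) ^ 2 * (Complex.I ^ 2 - 1) * Complex.I_sq
    · rw [Matrix.det_fin_two]
      fin_cases i <;> simp [tau, pauli] <;>
        first
        | linear_combination h - (Complex.sin t) ^ 2 * Complex.I_sq
        | linear_combination h + (Complex.sin t) ^ 2 * (Complex.I ^ 2 - 1) * Complex.I_sq⟩

theorem rot_zero (i : Fin 3) : rot i 0 = 1 := by
  apply Subtype.ext
  simp [rot]

theorem hasEntryDeriv_rot (i : Fin 3) : HasEntryDeriv (fun t => (rot i t).1) ((2 : ℂ) • tau i) := by
  intro a b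
  have hc := (Real.hasDerivAt_cos 0).ofReal_comp
  have hs := (Real.hasDerivAt_sin 0).ofReal_comp
  have h := (hc.mul_const ((1 : Matrix (Fin 2) (Fin 2) ℂ) a b)).fun_add
    ((hs.const_mul (2 : ℂ)).mul_const (tau i a b))
  simp only [Real.sin_zero, neg_zero, Real.cos_zero, Complex.ofReal_zero, Complex.ofReal_one,
    zero_mul, zero_add, mul_one] at h
  exact h

theorem trace_tau_mul_suVec (i : Fin 3) (v : Fin 3 → ℝ) :
    (tau i * suVec v).trace = -(1 / 2) * (v i : ℂ) := by
  fin_cases i <;>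
    simp [suVec, tau, pauli, Matrix.trace_fin_two, Fin.sum_univ_succ] <;>
    ring_nf <;> simp <;> ring

/-- The variation `X⁻_a exp(2 t τ^i)` of a single group element `X⁻_a`. -/
theorem exists_variation_fst (G : Fin 5 → Spin4) (a : Fin 5) (i : Fin 3) :
    ∃ c : ℝ → Fin 5 → Spin4, IsVariation G c ∧
      (∀ b, HasEntryDeriv (fun t => (c t b).1.1)
        (if b = a then (G a).1.1 * ((2 : ℂ) • tau i) else 0)) ∧
      ∀ b, HasEntryDeriv (fun t => (c t b).2.1) 0 := by
  set c : ℝ → Fin 5 → Spin4 := fun t b => if b = a then ((G a).1 * rot i t, (G a).2) else G b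
    with hc
  have h1 : ∀ b, HasEntryDeriv (fun t => (c t b).1.1)
      (if b = a then (G a).1.1 * ((2 : ℂ) • tau i) else 0) := by
    intro b
    by_cases hb : b = a
    · have h := (HasEntryDeriv.const (G a).1.1).mul (hasEntryDeriv_rot i)
      rw [zero_mul, zero_add] at h
      simp only [hc, hb, if_true]
      exact h
    · simp only [hc, if_neg hb]
      exact HasEntryDeriv.const _
  have h2 : ∀ b, HasEntryDeriv (fun t => (c t b).2.1) 0 := by
    intro b
    by_cases hb : b = a
    · simp only [hc, hb, if_true]
      exact HasEntryDeriv.const _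
    · simp only [hc, if_neg hb]
      exact HasEntryDeriv.const _
  refine ⟨c, ⟨?_, fun b j k => ⟨(h1 b j k).differentiableAt, (h2 b j k).differentiableAt⟩⟩, h1, h2⟩
  funext b
  by_cases hb : b = a
  · simp [hc, hb, rot_zero]
  · simp [hc, hb]

/-! ### Critical points -/

namespace BoundaryData

variable {D : BoundaryData γ} {hγ : γ ∈ Set.Ioo (0 : ℝ) 1} {θ : Fin 5 → Fin 5 → ℝ}
  {G : Fin 5 → Spin4}

theorem expAction_ne_zero (h : 1 ≤ ‖D.expAction hγ θ G‖) : D.expAction hγ θ G ≠ 0 := by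
  intro h0
  rw [h0, norm_zero] at h
  linarith

theorem conditions_of_isCriticalPoint (h : IsCriticalPoint (D.expAction hγ θ) G) :
    D.Closure ∧ D.Orientation G ∧ D.ProperOrientation G := by
  obtain ⟨S, hS, hstat, hre⟩ := h
  have h1 : 1 ≤ ‖D.expAction hγ θ G‖ := by
    rw [← hS.self_of_nhds, Complex.norm_exp]
    exact Real.one_le_exp hre
  have hE := expAction_ne_zero h1
  obtain ⟨hO, hP⟩ := (D.one_le_norm_expAction_iff hγ θ G).1 h1
  refine ⟨fun a => ?_, hO, hP⟩
  change D.closureVec a = 0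
  ext i
  -- The variation of `X⁻_a` along `exp(2 t τ^i)` isolates the `i`-th component of the closure vector.
  obtain ⟨c, hc, hA, hB⟩ := exists_variation_fst G a i
  have hd : HasDerivAt (fun t => D.expAction hγ θ (c t)) 0 0 := by
    have h := (hstat c hc).cexp
    rw [mul_zero] at h
    refine h.congr_of_eventuallyEq ?_
    filter_upwards [hc.tendsto.eventually hS] with t ht
    exact ht.symm
  obtain ⟨rfl, hc'⟩ := hc
  have h0 := (D.hasDerivAt_expAction hγ θ ⟨rfl, hc'⟩ hA hB hO hP).unique hd
  have h2 := (mul_eq_zero.1 ((mul_eq_zero.1 h0).resolve_left hE)).resolve_left Complex.I_ne_zero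
  rw [Finset.sum_eq_single a (fun b _ hb => by simp [if_neg hb]) (by simp)] at h2
  rw [if_pos rfl, ← mul_assoc, SU2.conjTranspose_mul, one_mul, Matrix.smul_mul,
    Matrix.trace_smul, trace_tau_mul_suVec] at h2
  simp only [mul_zero, zero_mul, Matrix.trace_zero, add_zero, smul_eq_mul] at h2
  have hγ' : (1 - γ : ℂ) ≠ 0 := by
    rw [← Complex.ofReal_one, ← Complex.ofReal_sub, Complex.ofReal_ne_zero]
    linarith [hγ.2]
  have h3 := (mul_eq_zero.1 h2).resolve_left hγ'
  have h4 : ((D.closureVec a i : ℝ) : ℂ) = 0 := by linear_combination -h3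
  exact Complex.ofReal_eq_zero.1 h4

theorem isCriticalPoint_of_conditions (hC : D.Closure) (hO : D.Orientation G)
    (hP : D.ProperOrientation G) : IsCriticalPoint (D.expAction hγ θ) G := by
  have h1 := (D.one_le_norm_expAction_iff hγ θ G).2 ⟨hO, hP⟩
  have hE := expAction_ne_zero h1
  -- Dividing by the value at `G` keeps the principal logarithm away from its cut.
  refine ⟨fun H => Complex.log (D.expAction hγ θ H / D.expAction hγ θ G) +
    Complex.log (D.expAction hγ θ G), ?_, fun c hc => ?_, ?_⟩
  · filter_upwards [(D.continuousAt_expAction hγ θ hO hP).eventually_ne hE] with H hH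
    rw [Complex.exp_add, Complex.exp_log (div_ne_zero hH hE), Complex.exp_log hE,
      div_mul_cancel₀ _ hE]
  · obtain ⟨A, B, hA, hB⟩ := hc.exists_hasEntryDeriv
    obtain ⟨rfl, hc'⟩ := hc
    have hd := D.hasDerivAt_expAction hγ θ ⟨rfl, hc'⟩ hA hB hO hP
    have hv : ∀ a, D.closureVec a = 0 := hC
    have hz : suVec (0 : EuclideanSpace ℝ (Fin 3)) = 0 := by simp [suVec]
    simp only [hv, hz, mul_zero, Matrix.trace_zero, add_zero, Finset.sum_const_zero] at hd
    have h2 := hd.div_const (D.expAction hγ θ (c 0))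
    rw [zero_div] at h2
    have h3 := h2.clog_real (by rw [div_self hE]; exact Complex.one_mem_slitPlane)
    rw [zero_div] at h3
    exact h3.add_const _
  · simp only [div_self hE, Complex.log_one, zero_add, Complex.log_re]
    exact Real.log_nonneg h1

end BoundaryData

end ProperEPRL

end

theorem mainTheorem3 (γ : ℝ) (hγ : γ ∈ Set.Ioo (0 : ℝ) 1) (D : ProperEPRL.BoundaryData γ)
    (θ : Fin 5 → Fin 5 → ℝ) (G : Fin 5 → ProperEPRL.Spin4) :
    ProperEPRL.IsCriticalPoint (D.expAction hγ θ) G ↔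
      D.Closure ∧ D.Orientation G ∧ D.ProperOrientation G :=
  ⟨ProperEPRL.BoundaryData.conditions_of_isCriticalPoint, fun h =>
    ProperEPRL.BoundaryData.isCriticalPoint_of_conditions h.1 h.2.1 h.2.2⟩
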